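/- Let $w\ge 2$. At an origin, $w$ paths (half-lines) lead off, and a goal is located at an unknown distance $n>0$ from the origin on one unknown path. A single robot starts at the origin and moves along the paths until it reaches the goal; its cost is the distance it has traveled by then. A deterministic exploration algorithm is a trajectory of the robot, and a randomized one is a probability distribution on trajectories. A randomized algorithm has competitive ratio $c$ if, for every path containing the goal, its expected cost is at most $c\,n+o(n)$ as $n\to\infty$. Let $R(w,1)$ be the infimum of the competitive ratios of all randomized exploration algorithms. The function $r\mapsto \frac{r^w-1}{(r-1)\ln r}$ has a unique minimizer $r_w$ on $(1,\infty)$. With $$\bar R(w)=1+\frac{2}{w}\cdot\frac{r_w^w-1}{(r_w-1)\ln r_w},$$ one has $R(w,1)\ge\bar R(w)$. Moreover, $R(w,1)=\bar R(w)$, and the competitive ratio $\bar R(w)$ is attained by the Kao–Reif–Tate algorithm, which is therefore optimal: choose a uniformly random permutation $\sigma$ of $\{0,\dots,w-1\}$ and, independently, $\varepsilon$ uniformly from $[0,1)$; for $j=0,1,2,\dots$, explore path $\sigma((j+1)\bmod w)$ up to distance $r_w^{\varepsilon+j}$ and return to the origin, until the goal is found. -/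

import Mathlib

open MeasureTheory Filter Asymptotics
open scoped NNReal ENNReal

noncomputable section

namespace PathSearch

/-- A deterministic exploration algorithm for one robot on `w` paths leaving a common origin.
`pos t p` is the robot's distance from the origin along path `p` when its odometer shows `t`
(and `0` if the robot is not on path `p`). As `∑ p, |pos t p - pos s p|` is the walking distance
between the two positions, `speed` says that the odometer never undercounts the distance traveled;
a robot that keeps moving can have an exact odometer. As long as the goal has
not been found the robot learns nothing, so a deterministic algorithm is such a trajectory. -/
@[ext]
structure Trajectory (w : ℕ) where
  pos : ℝ≥0 → Fin w → ℝ
  nonneg : ∀ t p, 0 ≤ pos t p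
  one_path : ∀ t p q, p ≠ q → pos t p = 0 ∨ pos t q = 0
  start : ∀ p, pos 0 p = 0
  speed : ∀ s t : ℝ≥0, ∑ p, |pos t p - pos s p| ≤ |(t : ℝ) - s|

/-- The σ-algebra generated by the positions at the individual odometer readings. -/
instance (w : ℕ) : MeasurableSpace (Trajectory w) :=
  MeasurableSpace.comap Trajectory.pos inferInstance

/-- The distance traveled until the goal at distance `n` on path `p` is found
(`∞` if it is never found). -/
def Trajectory.cost {w : ℕ} (γ : Trajectory w) (p : Fin w) (n : ℝ) : ℝ≥0∞ :=
  ⨅ (t : ℝ≥0) (_ : γ.pos t p = n), (t : ℝ≥0∞)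

/-- A randomized exploration algorithm: a probability distribution on deterministic ones. -/
abbrev RandomizedAlgorithm (w : ℕ) := ProbabilityMeasure (Trajectory w)

/-- The expected distance traveled until the goal at distance `n` on path `p` is found. -/
def RandomizedAlgorithm.expectedCost {w : ℕ} (A : RandomizedAlgorithm w) (p : Fin w) (n : ℝ) :
    ℝ≥0∞ :=
  ∫⁻ γ, γ.cost p n ∂(A : Measure (Trajectory w))

/-- `A` has competitive ratio `c`: wherever the goal is, at distance `n` from the origin, the
expected cost is at most `c * n + o(n)`. -/
def RandomizedAlgorithm.HasCompetitiveRatio {w : ℕ} (A : RandomizedAlgorithm w) (c : ℝ) : Prop :=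
  ∃ g : ℝ → ℝ, g =o[atTop] (fun n : ℝ => n) ∧
    ∀ (p : Fin w) (n : ℝ), 0 < n → RandomizedAlgorithm.expectedCost A p n ≤ ENNReal.ofReal (c * n + g n)

/-- `R(w,1)`: the infimum of the competitive ratios of all randomized exploration algorithms for
`w` paths and one robot. It is taken in `EReal`, so that it is `⊤` if there are none. -/
def R (w : ℕ) : EReal :=
  sInf {x : EReal | ∃ (A : RandomizedAlgorithm w) (c : ℝ),
    RandomizedAlgorithm.HasCompetitiveRatio A c ∧ x = (c : EReal)}

/-- `(r ^ w - 1) / ((r - 1) ln r)` -/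
def rateObjective (w : ℕ) (r : ℝ) : ℝ := (r ^ w - 1) / ((r - 1) * Real.log r)

/-- `r = r_w`: `r` minimizes `rateObjective w` over the reals greater than `1`. -/
def IsOptimalRate (w : ℕ) (r : ℝ) : Prop :=
  1 < r ∧ ∀ x : ℝ, 1 < x → rateObjective w r ≤ rateObjective w x

/-- `R̄(w)`, as a function of `r = r_w`. -/
def barR (w : ℕ) (r : ℝ) : ℝ := 1 + 2 / (w : ℝ) * rateObjective w r

/-- The robot proceeds in stages `0, 1, 2, …`: in stage `i` it walks from the origin along path
`a i` up to distance `h i` and then back to the origin, with an exact odometer. -/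
def Trajectory.Executes {w : ℕ} (γ : Trajectory w) (a : ℕ → Fin w) (h : ℕ → ℝ) : Prop :=
  ∀ (i : ℕ) (t : ℝ≥0), let τ : ℝ := ∑ j ∈ Finset.range i, 2 * h j
    τ ≤ t → t ≤ τ + 2 * h i → γ.pos t = Pi.single (a i) (min (t - τ) (τ + 2 * h i - t))

/-- `A` is the Kao–Reif–Tate algorithm with rate `r`: choose a uniformly random permutation `σ` of
the paths and, independently, `ε` uniformly from `[0, 1)`; then explore the paths
`σ 1, σ 2, …, σ (w - 1), σ 0, σ 1, …` in cyclic order, up to the distances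
`r ^ ε, r ^ ε * r, r ^ ε * r ^ 2, …`, returning to the origin each time. -/
def RandomizedAlgorithm.IsKaoReifTate {w : ℕ} [NeZero w] (A : RandomizedAlgorithm w) (r : ℝ) :
    Prop :=
  ∃ K : Equiv.Perm (Fin w) → ℝ → Trajectory w,
    (∀ σ, Measurable (K σ)) ∧
    (∀ σ, ∀ ε ∈ Set.Ico (0 : ℝ) 1,
      (K σ ε).Executes (fun j => σ (Fin.ofNat w (j + 1))) (fun j => r ^ ε * r ^ j)) ∧
    (A : Measure (Trajectory w)) = ((w.factorial : ℝ≥0∞)⁻¹) •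
      ∑ σ : Equiv.Perm (Fin w), Measure.map (K σ) (volume.restrict (Set.Ico (0 : ℝ) 1))

end PathSearch

end

noncomputable section

/-! Lower bound. Goals are placed at the distances `ρ ^ x`, `x ≤ K`, on every path, weighted so that
those from level `v` on have weight `ρ ^ (-v)` per path. Averaging the competitive bound over these
goals reduces the claim to a bound for each single trajectory. A stage, an excursion along one path
and back, delays all goals not found by its end, so it is charged twice its length times the
remaining weight (`IsHittingTimes.exists_stageCost_le`).

By the exchange argument `exchange`, stages may be taken with nondecreasing lengths. The state then
consists of the last `w` levels, `v 0 ≥ … ≥ v (w - 1)` once the new one is included, and the charge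
of a stage is, up to the factor `ρ` and an effect at the end of the grid, `∑ exp (u k)` with `u k =
log ρ * (v 0 - v k)`. Bounding `exp` from below by its tangent at `k * log r` is sharp when lengths
grow by the factor `r` per stage. The criticality equation for `r` cancels the constant terms, and
the linear terms are the increase of `potential`. Its total growth is `rateObjective w r * (K + 1)`,
up to the factor `log ρ` (`le_stageCost`). Dividing by `K` and letting `K → ∞`, then `ρ → 1`, gives
`barR w r ≤ c`.

Upper bound. The random `σ` makes the number of stages between the first sufficiently long one and
the next visit to the goal's path uniform on `0, …, w - 1`, which contributes the mean of `r ^ i`.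
The random `ε` makes the length of the first sufficiently long stage `n * r ^ U` with `U` uniform,
of mean `n * (r - 1) / log r`. Summing the geometric lengths gives exactly `barR w r * n`
(`expectedCost_krtAlgorithm_le`). -/

namespace PathSearch

/-! ### Stage sequences on a finite grid of goals

`d x` is the number of goals of level `x ≤ K` which are not yet found, `ω x` the weight of such a
goal and `H x` its distance from the origin. -/

/-- The total weight of the goals that are not yet found. -/
def remainingWeight (K : ℕ) (ω : ℕ → ℝ) (d : ℕ → ℕ) : ℝ :=
  ∑ x ∈ Finset.range (K + 1), ω x * d x

/-- A stage that reaches level `z` finds at most one further goal of each level up to `z`. -/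
def explore (z : ℕ) (d : ℕ → ℕ) : ℕ → ℕ := fun x => if x ≤ z then d x - 1 else d x

/-- Each stage is charged its length times the weight that remains after it; the weight remaining
at the very end is charged at the rate `Λ`. -/
def stageCost (K : ℕ) (H ω : ℕ → ℝ) (Λ : ℝ) : (ℕ → ℕ) → List ℕ → ℝ
  | d, [] => Λ * remainingWeight K ω d
  | d, z :: L => H z * remainingWeight K ω (explore z d) + stageCost K H ω Λ (explore z d) L

variable {K : ℕ} {H ω : ℕ → ℝ} {Λ : ℝ}

lemma explore_comm (y z : ℕ) (d : ℕ → ℕ) : explore y (explore z d) = explore z (explore y d) := by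
  funext x
  simp only [explore]
  split_ifs <;> rfl

/-- Monotonicity is the invariant behind the exchange argument: whenever a near goal is left, a goal
of every farther level is left too. -/
lemma monotone_explore (z : ℕ) {d : ℕ → ℕ} (hd : Monotone d) : Monotone (explore z d) := by
  intro x y hxy
  have := hd hxy
  simp only [explore]
  split_ifs <;> omega

lemma explore_le (z : ℕ) (d : ℕ → ℕ) (x : ℕ) : explore z d x ≤ d x := by
  simp only [explore]
  split_ifs <;> omega

lemma remainingWeight_nonneg (hω : ∀ x, 0 ≤ ω x) (d : ℕ → ℕ) : 0 ≤ remainingWeight K ω d :=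
  Finset.sum_nonneg fun x _ => mul_nonneg (hω x) (Nat.cast_nonneg _)

lemma remainingWeight_mono (hω : ∀ x, 0 ≤ ω x) {d e : ℕ → ℕ} (h : ∀ x, d x ≤ e x) :
    remainingWeight K ω d ≤ remainingWeight K ω e :=
  Finset.sum_le_sum fun x _ => mul_le_mul_of_nonneg_left (Nat.cast_le.2 (h x)) (hω x)

lemma stageCost_nonneg (hω : ∀ x, 0 ≤ ω x) (hH : ∀ x, 0 ≤ H x) (hΛ : 0 ≤ Λ) (L : List ℕ)
    (d : ℕ → ℕ) : 0 ≤ stageCost K H ω Λ d L := by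
  induction L generalizing d with
  | nil => exact mul_nonneg hΛ (remainingWeight_nonneg hω _)
  | cons z L ih => exact add_nonneg (mul_nonneg (hH z) (remainingWeight_nonneg hω _)) (ih _)

/-- The weight which a stage of level `b` finds. -/
def foundWeight (K : ℕ) (ω : ℕ → ℝ) (b : ℕ) (e : ℕ → ℕ) : ℝ :=
  ∑ x ∈ Finset.range (K + 1), if x ≤ b ∧ 1 ≤ e x then ω x else 0

/-- The weight of one goal of each level in `(b, a]`. -/
def weightBetween (K : ℕ) (ω : ℕ → ℝ) (b a : ℕ) : ℝ :=
  ∑ x ∈ Finset.range (K + 1), if b < x ∧ x ≤ a then ω x else 0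

lemma remainingWeight_eq_add_foundWeight (b : ℕ) (e : ℕ → ℕ) :
    remainingWeight K ω e = remainingWeight K ω (explore b e) + foundWeight K ω b e := by
  simp only [remainingWeight, foundWeight, ← Finset.sum_add_distrib]
  refine Finset.sum_congr rfl fun x _ => ?_
  simp only [explore]
  by_cases h1 : x ≤ b <;> by_cases h2 : 1 ≤ e x
  · simp only [h1, h2, and_self, if_true, Nat.cast_sub h2]
    push_cast
    ring
  · have : e x = 0 := by omega
    simp [this]
  · simp [h1]
  · simp [h1]

lemma foundWeight_mono (hω : ∀ x, 0 ≤ ω x) (b : ℕ) {d e : ℕ → ℕ} (h : ∀ x, d x ≤ e x) :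
    foundWeight K ω b d ≤ foundWeight K ω b e := by
  refine Finset.sum_le_sum fun x _ => ?_
  have := h x
  have := hω x
  split_ifs <;> first | omega | linarith

/-- Omitting a stage of level `b` loses at most what it would find, and if it loses anything then
extending this stage to level `a` finds one more goal of each level in `(b, a]`. -/
lemma exists_indicator (hω : ∀ x, 0 ≤ ω x) {a b : ℕ} (hba : b < a) {e : ℕ → ℕ}
    (he : Monotone e) {P : ℝ} (hP : foundWeight K ω b e ≤ P) :
    ∃ β : ℝ, 0 ≤ β ∧
      remainingWeight K ω e ≤ remainingWeight K ω (explore b e) + P * β ∧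
      remainingWeight K ω (explore a e) + weightBetween K ω b a * β ≤
        remainingWeight K ω (explore b e) := by
  by_cases h : ∃ x ≤ b, 1 ≤ e x
  · obtain ⟨x₀, hx₀, hx₁⟩ := h
    refine ⟨1, zero_le_one, ?_, ?_⟩
    · rw [remainingWeight_eq_add_foundWeight b e]
      linarith
    · rw [mul_one]
      simp only [remainingWeight, weightBetween, ← Finset.sum_add_distrib]
      refine Finset.sum_le_sum fun x _ => ?_
      have hx := hω x
      simp only [explore]
      by_cases h1 : x ≤ b
      · simp [h1, h1.trans hba.le, not_lt.2 h1]
      · by_cases h2 : x ≤ a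
        · have h3 : 1 ≤ e x := hx₁.trans (he (by omega))
          simp only [h1, h2, if_true, if_false, not_le.1 h1, and_self, Nat.cast_sub h3]
          push_cast
          linarith
        · simp [h1, h2]
  · push Not at h
    refine ⟨0, le_rfl, ?_, ?_⟩
    · have : foundWeight K ω b e = 0 := by
        refine Finset.sum_eq_zero fun x _ => ?_
        rw [if_neg]
        rintro ⟨h1, h2⟩
        have := h x h1
        omega
      rw [remainingWeight_eq_add_foundWeight b e, this]
      simp
    · simp only [mul_zero, add_zero]
      refine remainingWeight_mono hω fun x => ?_
      simp only [explore]
      split_ifs <;> omega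

/-- `B` adds up the later charges, `H z` or `Λ`, over the moments at which a goal of level at most
`b` is still left. The same `B` measures the loss from omitting the stage `b` and the gain from
extending it to `a`, so the two can be played off against each other. -/
lemma exists_tail_bound (hω : ∀ x, 0 ≤ ω x) (hH : ∀ x, 0 ≤ H x) (hΛ : 0 ≤ Λ) {a b : ℕ}
    (hba : b < a) (L : List ℕ) {P : ℝ} {e : ℕ → ℕ} (he : Monotone e)
    (hP : foundWeight K ω b e ≤ P) :
    ∃ B : ℝ, 0 ≤ B ∧
      stageCost K H ω Λ e L ≤ stageCost K H ω Λ (explore b e) L + P * B ∧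
      stageCost K H ω Λ (explore a e) L + weightBetween K ω b a * B ≤
        stageCost K H ω Λ (explore b e) L := by
  induction L generalizing e with
  | nil =>
    obtain ⟨β, h0, h1, h2⟩ := exists_indicator hω hba he hP
    refine ⟨Λ * β, mul_nonneg hΛ h0, ?_, ?_⟩
    · have := mul_le_mul_of_nonneg_left h1 hΛ
      simp only [stageCost]
      linarith
    · have := mul_le_mul_of_nonneg_left h2 hΛ
      simp only [stageCost]
      linarith
  | cons z L ih =>
    have he' := monotone_explore z he
    have hP' := (foundWeight_mono hω b (explore_le z e)).trans hP
    obtain ⟨β, h0, h1, h2⟩ := exists_indicator hω hba he' hP'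
    obtain ⟨B, h0', h1', h2'⟩ := ih he' hP'
    have hz := hH z
    have h3 := mul_le_mul_of_nonneg_left h1 hz
    have h4 := mul_le_mul_of_nonneg_left h2 hz
    refine ⟨H z * β + B, by positivity, ?_, ?_⟩
    · simp only [stageCost, explore_comm z b]
      linarith
    · simp only [stageCost, explore_comm z b, explore_comm z a]
      linarith

lemma remainingWeight_explore_le (hω : ∀ x, 0 ≤ ω x) {a b : ℕ} (d : ℕ → ℕ) :
    remainingWeight K ω (explore b d) ≤ remainingWeight K ω (explore b (explore a d)) +
      (foundWeight K ω b (explore a d) + weightBetween K ω b a) := by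
  simp only [remainingWeight, weightBetween, foundWeight, ← Finset.sum_add_distrib]
  refine Finset.sum_le_sum fun x _ => ?_
  have hx := hω x
  simp only [explore]
  by_cases h1 : x ≤ b
  · by_cases h2 : x ≤ a
    · by_cases h3 : 1 ≤ d x - 1
      · simp [h1, h2, h3, not_lt.2 h1, Nat.cast_sub h3]
        linarith
      · have : d x - 1 = 0 := by omega
        simp [h1, h2, not_lt.2 h1, this]
    · by_cases h3 : 1 ≤ d x <;> simp [h1, h2, h3, not_lt.2 h1, hx]
  · by_cases h2 : x ≤ a
    · by_cases h3 : 1 ≤ d x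
      · simp [h1, h2, not_le.1 h1, Nat.cast_sub h3]
        linarith
      · have : d x = 0 := by omega
        simp [h1, h2, not_le.1 h1, this, hx]
    · simp [h1, h2]

/-- If a stage is followed by a shorter one, then the cost does not increase if we swap the two,
drop the shorter one, or extend it to the length of the longer one. -/
lemma exchange (hω : ∀ x, 0 ≤ ω x) (hH : ∀ x, 0 ≤ H x) (hHm : StrictMono H) (hΛ : 0 ≤ Λ)
    {a b : ℕ} (hba : b < a) (L : List ℕ) {d : ℕ → ℕ} (hd : Monotone d) :
    stageCost K H ω Λ d (b :: a :: L) ≤ stageCost K H ω Λ d (a :: b :: L) ∨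
    stageCost K H ω Λ d (a :: L) ≤ stageCost K H ω Λ d (a :: b :: L) ∨
    stageCost K H ω Λ d (a :: a :: L) ≤ stageCost K H ω Λ d (a :: b :: L) := by
  by_contra! hcon
  obtain ⟨hswap, hdel, hraise⟩ := hcon
  obtain ⟨B, hB, h1, h2⟩ := exists_tail_bound (Λ := Λ) hω hH hΛ hba L (monotone_explore a hd)
    (le_refl (foundWeight K ω b (explore a d)))
  have h3 := remainingWeight_eq_add_foundWeight (K := K) (ω := ω) b (explore a d)
  have h4 := remainingWeight_explore_le (K := K) hω (a := a) (b := b) d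
  have h5 : remainingWeight K ω (explore a (explore a d)) ≤
      remainingWeight K ω (explore b (explore a d)) := by
    refine remainingWeight_mono hω fun x => ?_
    simp only [explore]
    split_ifs <;> omega
  have hHab := sub_pos.2 (hHm hba)
  have hb := hH b
  simp only [stageCost, explore_comm a b] at hswap hdel hraise
  set P := foundWeight K ω b (explore a d)
  set Q := weightBetween K ω b a
  set E₂ := remainingWeight K ω (explore b (explore a d))
  -- The failure of swapping gives `i1`, of dropping `i2`, of extending `i3`. Multiplied by `B`, `H
  -- a - H b` and `H b`, they form a cycle `H b * (H a - H b) * E₂ < (H a - H b) * P * B ≤ H b * Q *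
  -- B ≤ H b * (H a - H b) * E₂`.
  have i1 : (H a - H b) * P ≤ H b * Q := by
    have := mul_le_mul_of_nonneg_left h4 hb
    rw [h3] at hswap
    linarith
  have i2 : H b * E₂ < P * B := by linarith
  have i3 : Q * B ≤ (H a - H b) * E₂ := by
    have := mul_le_mul_of_nonneg_left h5 (hH a)
    linarith
  have j1 := mul_lt_mul_of_pos_left i2 hHab
  have j2 := mul_le_mul_of_nonneg_right i1 hB
  have j3 := mul_le_mul_of_nonneg_left i3 hb
  linarith

/-- Total defect of the levels of a list below `K + 1`. -/
def listDefect (K : ℕ) (L : List ℕ) : ℕ := (L.map fun z => K + 1 - z).sum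

/-- Defects weighted by position. -/
def weightedDefect (K : ℕ) : List ℕ → ℕ
  | [] => 0
  | z :: L => (K + 1 - z) + (weightedDefect K L + listDefect K L)

/-- All three exchanges lower `weightedDefect`: levels at most `K` have positive defect, and a swap
moves the larger defect forward, where it counts less. Control of `listDefect` is needed to pass the
decrease through a common prefix. -/
lemma exists_improvement (hω : ∀ x, 0 ≤ ω x) (hH : ∀ x, 0 ≤ H x) (hHm : StrictMono H)
    (hΛ : 0 ≤ Λ) (L : List ℕ) {d : ℕ → ℕ} (hd : Monotone d) (hL : ∀ z ∈ L, z ≤ K)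
    (hs : ¬ L.IsChain (· ≤ ·)) :
    ∃ L' : List ℕ, (∀ z ∈ L', z ≤ K) ∧ stageCost K H ω Λ d L' ≤ stageCost K H ω Λ d L ∧
      weightedDefect K L' < weightedDefect K L ∧ listDefect K L' ≤ listDefect K L := by
  induction L generalizing d with
  | nil => simp at hs
  | cons a L ih =>
    cases L with
    | nil => simp at hs
    | cons b L =>
      simp only [List.mem_cons, forall_eq_or_imp] at hL
      obtain ⟨haK, hbK, hLK⟩ := hL
      by_cases hab : a ≤ b
      · have hs' : ¬ (b :: L).IsChain (· ≤ ·) := fun h => hs (List.isChain_cons_cons.2 ⟨hab, h⟩)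
        obtain ⟨L', h1, h2, h3, h4⟩ := ih (monotone_explore a hd) (by simpa using ⟨hbK, hLK⟩) hs'
        refine ⟨a :: L', by simpa using ⟨haK, h1⟩, ?_, ?_, ?_⟩
        · rw [stageCost, stageCost.eq_def K H ω Λ d (a :: b :: L)]
          linarith
        · rw [weightedDefect, weightedDefect.eq_def K (a :: b :: L)]
          dsimp only
          omega
        · simp only [listDefect, List.map_cons, List.sum_cons] at h4 ⊢
          omega
      · push Not at hab
        rcases exchange (K := K) hω hH hHm hΛ hab L hd with h | h | h
        · refine ⟨_, ?_, h, ?_, ?_⟩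
          · simpa using ⟨hbK, haK, hLK⟩
          all_goals
            simp only [listDefect, weightedDefect, List.map_cons, List.sum_cons]
            omega
        · refine ⟨_, ?_, h, ?_, ?_⟩
          · simpa using ⟨haK, hLK⟩
          all_goals
            simp only [listDefect, weightedDefect, List.map_cons, List.sum_cons]
            omega
        · refine ⟨_, ?_, h, ?_, ?_⟩
          · simpa using ⟨haK, hLK⟩
          all_goals
            simp only [listDefect, weightedDefect, List.map_cons, List.sum_cons]
            omega

/-- It suffices to consider stages of nondecreasing length. -/
lemma exists_sorted (hω : ∀ x, 0 ≤ ω x) (hH : ∀ x, 0 ≤ H x) (hHm : StrictMono H) (hΛ : 0 ≤ Λ)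
    (L : List ℕ) {d : ℕ → ℕ} (hd : Monotone d) (hL : ∀ z ∈ L, z ≤ K) :
    ∃ L' : List ℕ, (∀ z ∈ L', z ≤ K) ∧ stageCost K H ω Λ d L' ≤ stageCost K H ω Λ d L ∧
      L'.IsChain (· ≤ ·) := by
  induction h : weightedDefect K L using Nat.strong_induction_on generalizing L with
  | _ n ih =>
    by_cases hs : L.IsChain (· ≤ ·)
    · exact ⟨L, hL, le_rfl, hs⟩
    · obtain ⟨L₁, h1, h2, h3, -⟩ := exists_improvement hω hH hHm hΛ L hd hL hs
      obtain ⟨L₂, h4, h5, h6⟩ := ih _ (h ▸ h3) L₁ h1 rfl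
      exact ⟨L₂, h4, h5.trans h2, h6⟩

/-! ### Stages of nondecreasing length on a geometric grid -/

/-- The weight of a goal at distance `ρ ^ x`; the goals from level `v ≤ K` on have the total
weight `ρ ^ (-v)`. -/
def gridWeight (ρ : ℝ) (K x : ℕ) : ℝ :=
  if x < K then (ρ ^ x)⁻¹ - (ρ ^ (x + 1))⁻¹ else (ρ ^ x)⁻¹

lemma gridWeight_pos {ρ : ℝ} (hρ : 1 < ρ) (K x : ℕ) : 0 < gridWeight ρ K x := by
  have h0 : 0 < ρ := by linarith
  rw [gridWeight]
  split_ifs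
  · rw [sub_pos]
    exact inv_strictAnti₀ (by positivity) (pow_lt_pow_right₀ hρ (Nat.lt_succ_self x))
  · positivity

lemma sum_gridWeight_tail (ρ : ℝ) (K v : ℕ) :
    ∑ x ∈ Finset.range (K + 1), (if v ≤ x then gridWeight ρ K x else 0) =
      if v ≤ K then (ρ ^ v)⁻¹ else 0 := by
  have key : ∀ j ≤ K, ∑ x ∈ Finset.range j, (if v ≤ x then gridWeight ρ K x else 0) =
      if v ≤ j then (ρ ^ v)⁻¹ - (ρ ^ j)⁻¹ else 0 := by
    intro j
    induction j with
    | zero =>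
      intro _
      by_cases h : v = 0 <;> simp [h]
    | succ j ih =>
      intro hj
      rw [Finset.sum_range_succ, ih (by omega)]
      simp only [gridWeight, if_pos (show j < K by omega)]
      rcases lt_trichotomy v (j + 1) with h | h | h
      · rw [if_pos (by omega), if_pos (by omega), if_pos (by omega)]
        ring
      · rw [if_neg (by omega), if_neg (by omega), if_pos (by omega), h]
        ring
      · rw [if_neg (by omega), if_neg (by omega), if_neg (by omega)]
        ring
  rw [Finset.sum_range_succ, key K le_rfl]
  split_ifs
  · simp [gridWeight]
  · simp

/-- The number of the paths, explored up to (excluding) the levels `v 0, …, v (w - 1)`, whose goal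
of level `x` is not yet found. -/
def unexplored (w : ℕ) (v : ℕ → ℕ) (x : ℕ) : ℕ := ∑ k ∈ Finset.range w, if v k ≤ x then 1 else 0

lemma remainingWeight_unexplored (ρ : ℝ) (K w : ℕ) (v : ℕ → ℕ) :
    remainingWeight K (gridWeight ρ K) (unexplored w v) =
      ∑ k ∈ Finset.range w, if v k ≤ K then (ρ ^ v k)⁻¹ else 0 := by
  simp only [remainingWeight, unexplored, Nat.cast_sum, Finset.mul_sum]
  rw [Finset.sum_comm]
  refine Finset.sum_congr rfl fun k _ => ?_
  rw [← sum_gridWeight_tail]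
  refine Finset.sum_congr rfl fun x _ => ?_
  split_ifs <;> simp

/-- Put a new level in front of a sequence of levels. -/
def consLevel (z : ℕ) (v : ℕ → ℕ) : ℕ → ℕ
  | 0 => z
  | k + 1 => v k

lemma consLevel_zero (z : ℕ) (v : ℕ → ℕ) : consLevel z v 0 = z := rfl

lemma consLevel_succ (z : ℕ) (v : ℕ → ℕ) (k : ℕ) : consLevel z v (k + 1) = v k := rfl

lemma antitone_consLevel {z : ℕ} {v : ℕ → ℕ} (hv : Antitone v) (hz : v 0 ≤ z) :
    Antitone (consLevel z v) := by
  refine antitone_nat_of_succ_le fun n => ?_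
  cases n with
  | zero => exact hz
  | succ n => exact hv (Nat.le_succ n)

/-- The oldest of the `w` levels is the lowest, so below the new level it is the one to be replaced;
above `z` all `w` goals are still left. Hence cyclic exploration finds a new goal of each level up
to `z` whenever one is left. -/
lemma explore_unexplored {w z : ℕ} (hw : 1 ≤ w) {v : ℕ → ℕ} (hv : Antitone v)
    (hz : v 0 ≤ z + 1) :
    explore z (unexplored w v) = unexplored w (consLevel (z + 1) v) := by
  obtain ⟨w, rfl⟩ : ∃ u, w = u + 1 := ⟨w - 1, by omega⟩
  funext x
  have hcons : unexplored (w + 1) (consLevel (z + 1) v) x =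
      (∑ k ∈ Finset.range w, if v k ≤ x then 1 else 0) + if z + 1 ≤ x then 1 else 0 :=
    Finset.sum_range_succ' (fun k => if consLevel (z + 1) v k ≤ x then 1 else 0) w
  rw [hcons]
  simp only [explore, unexplored]
  rw [Finset.sum_range_succ (fun k => if v k ≤ x then 1 else 0)]
  by_cases h : x ≤ z
  · rw [if_pos h, if_neg (show ¬ z + 1 ≤ x by omega)]
    by_cases h' : v w ≤ x
    · simp [h']
    · have : ∑ k ∈ Finset.range w, (if v k ≤ x then 1 else 0) = 0 := by
        refine Finset.sum_eq_zero fun k hk => if_neg ?_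
        have := hv (Finset.mem_range.1 hk).le
        omega
      simp [this, h']
  · rw [if_neg h, if_pos (show z + 1 ≤ x by omega), if_pos]
    have := hv (Nat.zero_le w)
    omega

/-- The potential of the state in which the last `w` stages reached the levels `v k - 1`. -/
def potential (w : ℕ) (r : ℝ) (v : ℕ → ℕ) : ℝ :=
  ∑ k ∈ Finset.range w, r ^ k * ∑ i ∈ Finset.range k, (v i : ℝ)

lemma potential_nonneg {r : ℝ} (hr : 0 ≤ r) (w : ℕ) (v : ℕ → ℕ) : 0 ≤ potential w r v :=
  Finset.sum_nonneg fun k _ => mul_nonneg (pow_nonneg hr k)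
    (Finset.sum_nonneg fun _ _ => Nat.cast_nonneg _)

/-- The inner sums before and after share all entries but the new first and the dropped last one. -/
lemma potential_consLevel_sub (w : ℕ) (r : ℝ) (z : ℕ) (v : ℕ → ℕ) :
    potential w r (consLevel z v) - potential w r v =
      ∑ k ∈ Finset.range w, r ^ k * ((z : ℝ) - consLevel z v k) := by
  simp only [potential, ← Finset.sum_sub_distrib]
  refine Finset.sum_congr rfl fun k _ => ?_
  have h1 := Finset.sum_range_succ (fun i => (consLevel z v i : ℝ)) k
  have h2 := Finset.sum_range_succ' (fun i => (consLevel z v i : ℝ)) k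
  simp only [consLevel_zero, consLevel_succ] at h2
  rw [← mul_sub]
  congr 1
  linarith

/-- This is the tangent of `exp` at `k * log r`. -/
lemma pow_mul_tangent_le_exp {r : ℝ} (hr : 0 < r) (k : ℕ) (u : ℝ) :
    r ^ k * (1 - k * Real.log r) + r ^ k * u ≤ Real.exp u := by
  have h1 := Real.add_one_le_exp (u - k * Real.log r)
  have h2 : Real.exp u = r ^ k * Real.exp (u - k * Real.log r) := by
    rw [Real.exp_sub, mul_comm (k : ℝ), ← Real.rpow_def_of_pos hr, Real.rpow_natCast]
    field_simp
  rw [h2]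
  have := mul_le_mul_of_nonneg_left h1 (pow_pos hr k).le
  linarith

/-- The increase of the potential in one stage is at most the cost of the stage. -/
lemma potential_increase_le {ρ r : ℝ} (hρ : 1 < ρ) (hr : 0 < r) {w : ℕ}
    (hcrit : ∑ k ∈ Finset.range w, r ^ k * (1 - k * Real.log r) = 0) {z : ℕ} (hz : z ≤ K)
    {v : ℕ → ℕ} (hv : Antitone v) (hvz : v 0 ≤ z + 1) :
    Real.log ρ * (potential w r (consLevel (z + 1) v) - potential w r v) -
        (if z = K then (w : ℝ) else 0) ≤
      ρ * (ρ ^ z * remainingWeight K (gridWeight ρ K) (unexplored w (consLevel (z + 1) v))) := by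
  have hρ0 : 0 < ρ := by linarith
  have hv' := antitone_consLevel hv hvz
  rw [potential_consLevel_sub, remainingWeight_unexplored, ← mul_assoc, ← pow_succ',
    Finset.mul_sum, Finset.mul_sum]
  have key : ∀ k ∈ Finset.range w,
      r ^ k * (1 - k * Real.log r) +
        Real.log ρ * (r ^ k * (((z + 1 : ℕ) : ℝ) - consLevel (z + 1) v k)) -
        (if z = K then (1 : ℝ) else 0) ≤
      ρ ^ (z + 1) * (if consLevel (z + 1) v k ≤ K then (ρ ^ consLevel (z + 1) v k)⁻¹ else 0) := by
    intro k _
    have hle : consLevel (z + 1) v k ≤ z + 1 := hv' (Nat.zero_le k)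
    have h1 := pow_mul_tangent_le_exp hr k
      (Real.log ρ * (((z + 1 : ℕ) : ℝ) - consLevel (z + 1) v k))
    have h2 : Real.exp (Real.log ρ * (((z + 1 : ℕ) : ℝ) - consLevel (z + 1) v k)) =
        ρ ^ (z + 1) * (ρ ^ consLevel (z + 1) v k)⁻¹ := by
      rw [← Real.rpow_def_of_pos hρ0, Real.rpow_sub hρ0, Real.rpow_natCast, Real.rpow_natCast,
        div_eq_mul_inv]
    rw [h2] at h1
    by_cases h : consLevel (z + 1) v k ≤ K
    · rw [if_pos h]
      have : (0 : ℝ) ≤ if z = K then (1 : ℝ) else 0 := by split_ifs <;> norm_num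
      linarith
    -- Past the end of the grid nothing remains, so the term that should be `1` is `0`. This happens
    -- only for a stage of level `K`, and costs at most `1` per index.
    · have hzK : z = K := by omega
      have h3 : consLevel (z + 1) v k = z + 1 := by omega
      rw [if_neg h, if_pos hzK]
      rw [h3] at h1 ⊢
      rw [mul_inv_cancel₀ (pow_pos hρ0 _).ne'] at h1
      linarith
  have hsum := Finset.sum_le_sum key
  rw [Finset.sum_sub_distrib, Finset.sum_add_distrib, hcrit, Finset.sum_const,
    Finset.card_range, nsmul_eq_mul] at hsum
  have : (w : ℝ) * (if z = K then (1 : ℝ) else 0) = if z = K then (w : ℝ) else 0 := by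
    split_ifs <;> simp
  linarith

lemma potential_of_unexplored_eq_zero (r : ℝ) {w : ℕ} {v : ℕ → ℕ} (hv : ∀ k, v k ≤ K + 1)
    (h : unexplored w v K = 0) :
    potential w r v = (∑ k ∈ Finset.range w, k * r ^ k) * (K + 1) := by
  have hk : ∀ k < w, v k = K + 1 := by
    intro k hk
    have h1 := (Finset.sum_eq_zero_iff.1 h) k (Finset.mem_range.2 hk)
    have h2 := hv k
    by_contra hne
    rw [if_pos (by omega)] at h1
    exact one_ne_zero h1
  rw [potential, Finset.sum_mul]
  refine Finset.sum_congr rfl fun k hkw => ?_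
  rw [Finset.sum_congr rfl (g := fun _ => ((K : ℝ) + 1)), Finset.sum_const, Finset.card_range,
    nsmul_eq_mul]
  · ring
  · intro i hi
    rw [hk i ((Finset.mem_range.1 hi).trans (Finset.mem_range.1 hkw))]
    push_cast
    rfl

/-- The potential is telescoped along the list. The term `w * unexplored w v K` pays for the
boundary loss of `w` in each stage of level `K`, as such a stage finds one goal of level `K`. If the
list ends early, an unfound goal of level `K` has weight `(ρ ^ K)⁻¹`, and `Λ` is large enough for
this alone to cover the bound. -/
lemma le_stageCost_of_pairwise {ρ r Λ : ℝ} (hρ : 1 < ρ) (hr : 0 < r) {w : ℕ} (hw : 1 ≤ w)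
    (hcrit : ∑ k ∈ Finset.range w, r ^ k * (1 - k * Real.log r) = 0) (hΛ : 0 ≤ Λ)
    (hΛ' : Real.log ρ * ((∑ k ∈ Finset.range w, k * r ^ k) * (K + 1)) * ρ ^ K ≤ ρ * Λ)
    (L : List ℕ) (hL : ∀ z ∈ L, z ≤ K) (hs : L.Pairwise (· ≤ ·)) {v : ℕ → ℕ} (hv : Antitone v)
    (hvK : v 0 ≤ K + 1) (hvL : ∀ z ∈ L, v 0 ≤ z + 1) :
    Real.log ρ * ((∑ k ∈ Finset.range w, k * r ^ k) * (K + 1) - potential w r v) -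
        w * unexplored w v K ≤
      ρ * stageCost K (fun x => ρ ^ x) (gridWeight ρ K) Λ (unexplored w v) L := by
  have hρ0 : 0 < ρ := by linarith
  have hω : ∀ x, 0 ≤ gridWeight ρ K x := fun x => (gridWeight_pos hρ K x).le
  have hvK' : ∀ k, v k ≤ K + 1 := fun k => (hv (Nat.zero_le k)).trans hvK
  have hlog := Real.log_pos hρ
  by_cases h0 : unexplored w v K = 0
  · rw [potential_of_unexplored_eq_zero r hvK' h0, h0]
    simp only [sub_self, mul_zero, Nat.cast_zero]
    exact mul_nonneg hρ0.le (stageCost_nonneg hω (fun x => (pow_pos hρ0 x).le) hΛ L _)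
  have h1 : 1 ≤ unexplored w v K := by omega
  induction L generalizing v with
  | nil =>
    have h2 : (ρ ^ K)⁻¹ ≤ remainingWeight K (gridWeight ρ K) (unexplored w v) := by
      have := Finset.single_le_sum (f := fun x => gridWeight ρ K x * (unexplored w v x : ℝ))
        (fun x _ => mul_nonneg (hω x) (Nat.cast_nonneg _))
        (Finset.mem_range.2 (Nat.lt_succ_self K))
      refine le_trans ?_ this
      have hK : gridWeight ρ K K = (ρ ^ K)⁻¹ := by simp [gridWeight]
      rw [hK]
      exact le_mul_of_one_le_right (by positivity) (by exact_mod_cast h1)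
    have h3 : Real.log ρ * ((∑ k ∈ Finset.range w, k * r ^ k) * (K + 1)) ≤
        ρ * (Λ * remainingWeight K (gridWeight ρ K) (unexplored w v)) := by
      calc _ = Real.log ρ * ((∑ k ∈ Finset.range w, k * r ^ k) * (K + 1)) * ρ ^ K
              * (ρ ^ K)⁻¹ := by field_simp
        _ ≤ ρ * Λ * (ρ ^ K)⁻¹ := by gcongr
        _ ≤ ρ * Λ * remainingWeight K (gridWeight ρ K) (unexplored w v) := by gcongr
        _ = _ := by ring
    have h4 := mul_nonneg hlog.le (potential_nonneg hr.le w v)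
    have h5 : (0 : ℝ) ≤ w * unexplored w v K := by positivity
    rw [stageCost]
    linarith
  | cons z L ih =>
    obtain ⟨hzK, hLK⟩ := List.forall_mem_cons.1 hL
    obtain ⟨hvz, -⟩ := List.forall_mem_cons.1 hvL
    obtain ⟨hzL, hs'⟩ := List.pairwise_cons.1 hs
    have hstep := potential_increase_le hρ hr hcrit hzK hv hvz
    have hexp := explore_unexplored hw hv hvz
    have hv' := antitone_consLevel hv hvz
    have hcount : unexplored w (consLevel (z + 1) v) K =
        if z = K then unexplored w v K - 1 else unexplored w v K := by
      rw [← hexp, explore]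
      congr 1
      rw [eq_iff_iff]
      omega
    have hrest : Real.log ρ * ((∑ k ∈ Finset.range w, k * r ^ k) * (K + 1) -
          potential w r (consLevel (z + 1) v)) - w * unexplored w (consLevel (z + 1) v) K ≤
        ρ * stageCost K (fun x => ρ ^ x) (gridWeight ρ K) Λ
          (unexplored w (consLevel (z + 1) v)) L := by
      have hK' : ∀ k, consLevel (z + 1) v k ≤ K + 1 := fun k =>
        (hv' (Nat.zero_le k)).trans (show z + 1 ≤ K + 1 by omega)
      by_cases h0' : unexplored w (consLevel (z + 1) v) K = 0
      · rw [potential_of_unexplored_eq_zero r hK' h0', h0']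
        simp only [sub_self, mul_zero, Nat.cast_zero]
        exact mul_nonneg hρ0.le (stageCost_nonneg hω (fun x => (pow_pos hρ0 x).le) hΛ L _)
      · exact ih hLK hs' hv' (hK' 0) (fun y hy => Nat.succ_le_succ (hzL y hy)) hK' h0' (by omega)
    rw [stageCost, hexp]
    have hcount' : (w : ℝ) * unexplored w (consLevel (z + 1) v) K =
        w * unexplored w v K - if z = K then (w : ℝ) else 0 := by
      rw [hcount]
      split_ifs
      · rw [Nat.cast_sub h1]
        push_cast
        ring
      · ring
    linarith

/-- The lower bound for arbitrary sequences of stages. -/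
theorem le_stageCost {ρ r Λ : ℝ} (hρ : 1 < ρ) (hr : 0 < r) {w : ℕ} (hw : 1 ≤ w)
    (hcrit : ∑ k ∈ Finset.range w, r ^ k * (1 - k * Real.log r) = 0) (hΛ : 0 ≤ Λ)
    (hΛ' : Real.log ρ * ((∑ k ∈ Finset.range w, k * r ^ k) * (K + 1)) * ρ ^ K ≤ ρ * Λ)
    (L : List ℕ) (hL : ∀ z ∈ L, z ≤ K) :
    Real.log ρ * ((∑ k ∈ Finset.range w, k * r ^ k) * (K + 1)) - w * w ≤
      ρ * stageCost K (fun x => ρ ^ x) (gridWeight ρ K) Λ (fun _ => w) L := by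
  have hρ0 : 0 < ρ := by linarith
  obtain ⟨L', h1, h2, h3⟩ := exists_sorted (d := fun _ => w) (K := K)
    (fun x => (gridWeight_pos hρ K x).le)
    (fun x => (pow_pos hρ0 x).le) (pow_right_strictMono₀ hρ) hΛ L monotone_const hL
  have hun : unexplored w (fun _ => 0) = fun _ => w := by
    funext x
    simp [unexplored]
  have h4 := le_stageCost_of_pairwise hρ hr hw hcrit hΛ hΛ' L' h1 (List.isChain_iff_pairwise.1 h3)
    (v := fun _ => 0) antitone_const (by omega) (fun _ _ => by omega)
  rw [hun] at h4
  have h5 : potential w r (fun _ => 0) = 0 := by simp [potential]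
  rw [h5, sub_zero] at h4
  exact h4.trans (mul_le_mul_of_nonneg_left h2 hρ0.le)

/-! ### The optimal rate -/

lemma rateObjective_eq (w : ℕ) {r : ℝ} (hr : 1 < r) :
    rateObjective w r = (∑ k ∈ Finset.range w, r ^ k) / Real.log r := by
  have h1 : r - 1 ≠ 0 := by linarith
  rw [rateObjective, geom_sum_eq (by linarith), div_div]

lemma rateObjective_nonneg (w : ℕ) {r : ℝ} (hr : 1 < r) : 0 ≤ rateObjective w r := by
  have hr0 : 0 < r := by linarith
  rw [rateObjective_eq w hr]
  exact div_nonneg (Finset.sum_nonneg fun k _ => by positivity) (Real.log_pos hr).le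

/-- `r` is a critical point of the objective. -/
def IsCriticalRate (w : ℕ) (r : ℝ) : Prop :=
  1 < r ∧ ∑ k ∈ Finset.range w, r ^ k * (1 - k * Real.log r) = 0

/-- The sum is `w` at `1`. At `exp 2` its first two terms give `1 - exp 2 < 0`, and the others are
nonpositive. -/
lemma exists_isCriticalRate {w : ℕ} (hw : 2 ≤ w) : ∃ r, IsCriticalRate w r := by
  have hcont : ContinuousOn
      (fun r : ℝ => ∑ k ∈ Finset.range w, r ^ k * (1 - k * Real.log r)) (Set.Icc 1 (Real.exp 2)) := by
    refine continuousOn_finsetSum _ fun k _ => ?_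
    refine (continuousOn_pow k).mul (continuousOn_const.sub (continuousOn_const.mul ?_))
    exact Real.continuousOn_log.mono fun x hx => by
      have := hx.1
      simp only [Set.mem_compl_iff, Set.mem_singleton_iff]
      linarith
  have h1 : (0 : ℝ) < ∑ k ∈ Finset.range w, (1 : ℝ) ^ k * (1 - k * Real.log 1) := by
    simp
    omega
  have h2 : ∑ k ∈ Finset.range w, Real.exp 2 ^ k * (1 - k * Real.log (Real.exp 2)) < 0 := by
    obtain ⟨u, rfl⟩ : ∃ u, w = u + 2 := ⟨w - 2, by omega⟩
    rw [Finset.sum_range_succ', Finset.sum_range_succ']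
    have h3 : ∑ k ∈ Finset.range u,
        Real.exp 2 ^ (k + 1 + 1) * (1 - ((k + 1 + 1 : ℕ) : ℝ) * Real.log (Real.exp 2)) ≤ 0 := by
      refine Finset.sum_nonpos fun k _ => mul_nonpos_of_nonneg_of_nonpos (by positivity) ?_
      rw [Real.log_exp]
      push_cast
      have : (0 : ℝ) ≤ k := Nat.cast_nonneg k
      linarith
    have h4 := Real.add_one_le_exp (2 : ℝ)
    rw [Real.log_exp] at h3 ⊢
    norm_num at h3 ⊢
    linarith
  obtain ⟨r, ⟨hr1, -⟩, hr⟩ := intermediate_value_Icc' (Real.one_le_exp (by norm_num)) hcont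
    ⟨h2.le, h1.le⟩
  refine ⟨r, lt_of_le_of_ne hr1 ?_, hr⟩
  rintro rfl
  exact h1.ne' hr

lemma IsCriticalRate.sum_eq {w : ℕ} {r : ℝ} (h : IsCriticalRate w r) :
    rateObjective w r = ∑ k ∈ Finset.range w, k * r ^ k := by
  have hlog := Real.log_pos h.1
  rw [rateObjective_eq w h.1, div_eq_iff hlog.ne', Finset.sum_mul, ← sub_eq_zero,
    ← Finset.sum_sub_distrib, ← h.2]
  exact Finset.sum_congr rfl fun k _ => by ring

/-- Each `x ^ k`, as an exponential in `log x`, lies above its tangent at `log r`. Criticality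
cancels the constants in the sum, leaving `log x * ∑ k * r ^ k`; the term `k = 1` is strict. -/
lemma IsCriticalRate.lt {w : ℕ} (hw : 2 ≤ w) {r : ℝ} (h : IsCriticalRate w r) {x : ℝ}
    (hx : 1 < x) (hne : x ≠ r) : rateObjective w r < rateObjective w x := by
  have hr0 : 0 < r := by linarith [h.1]
  have hx0 : 0 < x := by linarith
  have hlog := Real.log_pos hx
  rw [h.sum_eq, rateObjective_eq w hx, lt_div_iff₀ hlog, Finset.sum_mul]
  have hpow : ∀ k : ℕ, x ^ k = r ^ k * Real.exp (k * (Real.log x - Real.log r)) := by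
    intro k
    rw [Real.exp_nat_mul, Real.exp_sub, Real.exp_log hx0, Real.exp_log hr0, ← mul_pow,
      mul_div_cancel₀ _ hr0.ne']
  have hle : ∀ k ∈ Finset.range w, r ^ k * (1 - k * Real.log r) + k * r ^ k * Real.log x ≤
      x ^ k := by
    intro k _
    rw [hpow k]
    have := mul_le_mul_of_nonneg_left (Real.add_one_le_exp (k * (Real.log x - Real.log r)))
      (pow_pos hr0 k).le
    linarith
  have hlt : r ^ 1 * (1 - (1 : ℕ) * Real.log r) + (1 : ℕ) * r ^ 1 * Real.log x < x ^ 1 := by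
    rw [hpow 1]
    have hne' : ((1 : ℕ) : ℝ) * (Real.log x - Real.log r) ≠ 0 := by
      rw [Nat.cast_one, one_mul, sub_ne_zero]
      exact fun h => hne (Real.log_injOn_pos hx0 hr0 h)
    have := mul_lt_mul_of_pos_left (Real.add_one_lt_exp hne') (pow_pos hr0 1)
    linarith
  have := Finset.sum_lt_sum hle ⟨1, Finset.mem_range.2 (by omega), hlt⟩
  rw [Finset.sum_add_distrib, h.2, zero_add] at this
  exact this

lemma IsCriticalRate.isOptimalRate {w : ℕ} (hw : 2 ≤ w) {r : ℝ} (h : IsCriticalRate w r) :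
    IsOptimalRate w r := by
  refine ⟨h.1, fun x hx => ?_⟩
  rcases eq_or_ne x r with rfl | hne
  · rfl
  · exact (h.lt hw hx hne).le

lemma IsOptimalRate.isCriticalRate {w : ℕ} (hw : 2 ≤ w) {r : ℝ} (h : IsOptimalRate w r) :
    IsCriticalRate w r := by
  obtain ⟨s, hs⟩ := exists_isCriticalRate hw
  rcases eq_or_ne r s with rfl | hne
  · exact hs
  · exact absurd (hs.lt hw h.1 hne) (not_lt.2 (h.2 s hs.1))

lemma existsUnique_isOptimalRate {w : ℕ} (hw : 2 ≤ w) : ∃! r, IsOptimalRate w r := by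
  obtain ⟨s, hs⟩ := exists_isCriticalRate hw
  refine ⟨s, hs.isOptimalRate hw, fun r hr => ?_⟩
  by_contra hne
  exact absurd (hs.lt hw hr.1 hne) (not_lt.2 (hr.2 s hs.1))

/-! ### From hitting times to stages -/

/-- List the stages `e ∈ s`, which end at level `ℓ e`, in the order of the times `τ e`. -/
lemma exists_list_stageCost_eq {ι : Type*} [DecidableEq ι] (K : ℕ) (n ω : ℕ → ℝ) (Λ : ℝ)
    (τ : ι → ℝ) (ℓ : ι → ℕ) (s : Finset ι) (hτ : Set.InjOn τ s) :
    ∃ L : List ℕ, (∀ z ∈ L, ∃ e ∈ s, ℓ e = z) ∧ ∀ d : ℕ → ℕ, stageCost K n ω Λ d L =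
      (∑ e ∈ s, n (ℓ e) * remainingWeight K ω
        fun y => d y - (s.filter fun e' => τ e' ≤ τ e ∧ y ≤ ℓ e').card) +
      Λ * remainingWeight K ω fun y => d y - (s.filter fun e' => y ≤ ℓ e').card := by
  -- The earliest stage is split off and becomes the head of the list.
  induction s using Finset.induction_on_min_value τ with
  | empty => exact ⟨[], by simp, fun d => by simp [stageCost]⟩
  | insert a s ha hmin ih =>
    rw [Finset.coe_insert, Set.injOn_insert (by simpa using ha)] at hτ
    obtain ⟨L, hL, hcost⟩ := ih hτ.1
    have hlt : ∀ e ∈ s, τ a < τ e := fun e he =>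
      lt_of_le_of_ne (hmin e he) fun h => hτ.2 ⟨e, he, h.symm⟩
    refine ⟨ℓ a :: L, ?_, fun d => ?_⟩
    · simp only [List.mem_cons, Finset.mem_insert]
      rintro z (rfl | hz)
      · exact ⟨a, Or.inl rfl, rfl⟩
      · obtain ⟨e, he, h⟩ := hL z hz
        exact ⟨e, Or.inr he, h⟩
    · have hcard : ∀ (P : ι → Prop) [DecidablePred P] (y : ℕ), (P a ↔ y ≤ ℓ a) →
          d y - ((insert a s).filter P).card = explore (ℓ a) d y - (s.filter P).card := by
        intro P _ y hP
        rw [Finset.filter_insert, explore]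
        by_cases h : y ≤ ℓ a
        · rw [if_pos (hP.2 h), if_pos h, Finset.card_insert_of_notMem (by simp [ha])]
          omega
        · rw [if_neg (fun h' => h (hP.1 h')), if_neg h]
      have hself : (fun y => d y -
          ((insert a s).filter fun e' => τ e' ≤ τ a ∧ y ≤ ℓ e').card) = explore (ℓ a) d := by
        funext y
        rw [hcard _ y (by simp), Finset.filter_eq_empty_iff.2, Finset.card_empty, Nat.sub_zero]
        rintro e he ⟨h, -⟩
        exact absurd (hlt e he) (not_lt.2 h)
      rw [stageCost, hcost, Finset.sum_insert ha, hself, add_assoc]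
      congr 2
      · refine Finset.sum_congr rfl fun e he => ?_
        congr 2
        funext y
        rw [hcard _ y (by simp [(hlt e he).le])]
      · congr 2
        funext y
        rw [hcard _ y Iff.rfl]

/-- `T p x` is the time at which the goal at distance `n x` on path `p` is hit, for `x ≤ K`. -/
structure IsHittingTimes (K w : ℕ) (n : ℕ → ℝ) (T : Fin w → ℕ → ℝ) : Prop where
  pos : ∀ x, 0 < n x
  le : ∀ p, ∀ x ≤ K, n x ≤ T p x
  mono : ∀ p x y, x < y → y ≤ K → T p x < T p y
  switch : ∀ p q x y, p ≠ q → x ≤ K → y ≤ K → T p x ≤ T q y → T p x + n x + n y ≤ T q y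

/-- The goals `(p, x)` after which another path is visited before the next goal on `p` is hit. -/
def turns (K w : ℕ) (T : Fin w → ℕ → ℝ) : Finset (Fin w × ℕ) := by
  classical
  exact (Finset.univ ×ˢ Finset.range (K + 1)).filter fun e =>
    e.2 = K ∨ ∃ q ≠ e.1, ∃ y ≤ K, T e.1 e.2 < T q y ∧ T q y < T e.1 (e.2 + 1)

lemma mem_turns {K w : ℕ} {T : Fin w → ℕ → ℝ} {e : Fin w × ℕ} : e ∈ turns K w T ↔
    e.2 ≤ K ∧ (e.2 = K ∨ ∃ q ≠ e.1, ∃ y ≤ K, T e.1 e.2 < T q y ∧ T q y < T e.1 (e.2 + 1)) := by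
  simp [turns]

namespace IsHittingTimes

variable {K w : ℕ} {n : ℕ → ℝ} {T : Fin w → ℕ → ℝ}

lemma injOn (h : IsHittingTimes K w n T) {s : Finset (Fin w × ℕ)} (hs : ∀ e ∈ s, e.2 ≤ K) :
    Set.InjOn (fun e : Fin w × ℕ => T e.1 e.2) s := by
  rintro ⟨p, x⟩ hx ⟨q, y⟩ hy hxy
  have hx' : x ≤ K := hs _ hx
  have hy' : y ≤ K := hs _ hy
  dsimp only at hxy
  by_cases hpq : p = q
  · subst hpq
    rcases lt_trichotomy x y with h' | h' | h'
    · exact absurd hxy (h.mono p x y h' hy').ne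
    · rw [h']
    · exact absurd hxy (h.mono p y x h' hx').ne'
  · have h1 := h.switch p q x y hpq hx' hy' hxy.le
    have h2 := h.pos x
    have h3 := h.pos y
    linarith

lemma mono' (h : IsHittingTimes K w n T) (p : Fin w) {x y : ℕ} (hxy : x ≤ y) (hy : y ≤ K) :
    T p x ≤ T p y := by
  rcases hxy.eq_or_lt with rfl | h'
  · rfl
  · exact (h.mono p x y h' hy).le

/-- After a turn the robot must pass the origin before it hits any further goal. If that goal is on
the same path, a goal on another path lies in between and two switches are used. -/
lemma add_two_mul_le_of_mem_turns (h : IsHittingTimes K w n T) {e : Fin w × ℕ}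
    (he : e ∈ turns K w T) {q : Fin w} {y : ℕ} (hy : y ≤ K) (hlt : T e.1 e.2 < T q y) :
    T e.1 e.2 - n e.2 + 2 * n e.2 ≤ T q y - n y := by
  obtain ⟨p, x⟩ := e
  obtain ⟨hx, he⟩ := mem_turns.1 he
  dsimp only at *
  by_cases hpq : p = q
  · subst hpq
    have hxy : x < y := by
      by_contra hcon
      exact absurd hlt (not_lt.2 (h.mono' p (not_lt.1 hcon) hx))
    obtain rfl | ⟨q, hq, z, hz, h1, h2⟩ := he
    · omega
    · have h3 := h.switch p q x z hq.symm hx hz h1.le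
      have h4 := h.switch q p z y hq hz hy (h2.le.trans (h.mono' p hxy hy))
      have := h.pos z
      linarith
  · have := h.switch p q x y hpq hx hy hlt.le
    linarith

/-- Before a goal is hit, the robot walks to the end of each earlier stage and back. -/
lemma sum_turns_le (h : IsHittingTimes K w n T) (q : Fin w) {y : ℕ} (hy : y ≤ K) :
    2 * ∑ e ∈ (turns K w T).filter (fun e => T e.1 e.2 < T q y), n e.2 ≤ T q y - n y := by
  induction hs : ((turns K w T).filter (fun e => T e.1 e.2 < T q y)).card
    using Nat.strong_induction_on generalizing q y with
  | _ m ih =>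
    rcases ((turns K w T).filter (fun e => T e.1 e.2 < T q y)).eq_empty_or_nonempty with h0 | hne
    · rw [h0]
      simpa using h.le q y hy
    · obtain ⟨e, he, hmax⟩ := Finset.exists_max_image _ (fun e => T e.1 e.2) hne
      obtain ⟨heT, hlt⟩ := Finset.mem_filter.1 he
      have heK := (mem_turns.1 heT).1
      have hins : (turns K w T).filter (fun e => T e.1 e.2 < T q y) =
          insert e ((turns K w T).filter (fun e' => T e'.1 e'.2 < T e.1 e.2)) := by
        ext e'
        simp only [Finset.mem_insert, Finset.mem_filter]
        constructor
        · intro h'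
          rcases (hmax e' (Finset.mem_filter.2 h')).lt_or_eq with h1 | h1
          · exact Or.inr ⟨h'.1, h1⟩
          · exact Or.inl (h.injOn (s := turns K w T) (fun e he => (mem_turns.1 he).1) h'.1 heT h1)
        · rintro (rfl | ⟨h1, h2⟩)
          · exact ⟨heT, hlt⟩
          · exact ⟨h1, h2.trans hlt⟩
      have hnot : e ∉ (turns K w T).filter (fun e' => T e'.1 e'.2 < T e.1 e.2) := by simp
      have hcard : ((turns K w T).filter (fun e' => T e'.1 e'.2 < T e.1 e.2)).card < m := by
        rw [← hs, hins, Finset.card_insert_of_notMem hnot]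
        omega
      have h1 := ih _ hcard e.1 heK rfl
      have h2 := h.add_two_mul_le_of_mem_turns heT hy hlt
      rw [hins, Finset.sum_insert hnot]
      linarith

/-- Each path whose goal of level `x` is hit by the end of a stage has been explored beyond this
goal in one of the stages up to this one. -/
lemma card_hit_le (h : IsHittingTimes K w n T) {e : Fin w × ℕ} (he : e ∈ turns K w T) {x : ℕ}
    (hx : x ≤ K) :
    (Finset.univ.filter fun p => T p x ≤ T e.1 e.2).card ≤
      ((turns K w T).filter fun e' => T e'.1 e'.2 ≤ T e.1 e.2 ∧ x ≤ e'.2).card := by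
  have key : ∀ p, T p x ≤ T e.1 e.2 →
      ∃ y, (p, y) ∈ turns K w T ∧ T p y ≤ T e.1 e.2 ∧ x ≤ y := by
    intro p hp
    by_cases hpe : p = e.1
    · subst hpe
      refine ⟨e.2, he, le_rfl, ?_⟩
      by_contra hcon
      exact absurd (h.mono _ _ _ (not_le.1 hcon) hx) (not_lt.2 hp)
    · have hne : ((Finset.range (K + 1)).filter fun y => T p y ≤ T e.1 e.2).Nonempty :=
        ⟨x, by simp [hp, hx]⟩
      obtain ⟨y, hy, hmax⟩ := Finset.exists_max_image _ id hne
      simp only [Finset.mem_filter, Finset.mem_range, Nat.lt_succ_iff, id] at hy hmax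
      refine ⟨y, mem_turns.2 ⟨hy.1, ?_⟩, hy.2, hmax x ⟨hx, hp⟩⟩
      rcases hy.1.eq_or_lt with h1 | h1
      · exact Or.inl h1
      · refine Or.inr ⟨e.1, Ne.symm hpe, e.2, (mem_turns.1 he).1, ?_, ?_⟩
        · have h2 := h.switch p e.1 y e.2 hpe hy.1 (mem_turns.1 he).1 hy.2
          have := h.pos y
          have := h.pos e.2
          dsimp only
          linarith
        · by_contra hcon
          have := hmax (y + 1) ⟨h1, not_lt.1 hcon⟩
          omega
  choose! f hf using key
  refine Finset.card_le_card_of_injOn (fun p => (p, f p)) ?_ ?_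
  · intro p hp
    have := hf p (by simpa using hp)
    simpa using this
  · intro p _ q _ hpq
    exact (Prod.mk.inj hpq).1

/-- Interchanging the sums turns the charges of stages for remaining goals into the delays of goals
by earlier turns, bounded by `sum_turns_le`. `Λ` is arbitrary because every goal is eventually
found; it matters only after the exchange argument has dropped stages. -/
lemma exists_stageCost_le (h : IsHittingTimes K w n T) {ω : ℕ → ℝ} (hω : ∀ x, 0 ≤ ω x) (Λ : ℝ) :
    ∃ L : List ℕ, (∀ z ∈ L, z ≤ K) ∧ 2 * stageCost K n ω Λ (fun _ => w) L ≤
      ∑ p, ∑ x ∈ Finset.range (K + 1), ω x * (T p x - n x) := by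
  classical
  obtain ⟨L, hL, hcost⟩ := exists_list_stageCost_eq K n ω Λ (fun e : Fin w × ℕ => T e.1 e.2)
    (fun e => e.2) (turns K w T) (h.injOn fun e he => (mem_turns.1 he).1)
  refine ⟨L, ?_, ?_⟩
  · intro z hz
    obtain ⟨e, he, rfl⟩ := hL z hz
    exact (mem_turns.1 he).1
  have hend : remainingWeight K ω
      (fun y => w - ((turns K w T).filter fun e' => y ≤ e'.2).card) = 0 := by
    refine Finset.sum_eq_zero fun x hx => ?_
    have hxK : x ≤ K := by simpa [Nat.lt_succ_iff] using hx
    -- The last goal of each path counts as a turn, which already gives `w` stages reaching level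
    -- `x`.
    have : w ≤ ((turns K w T).filter fun e' => x ≤ e'.2).card := by
      calc w = (Finset.univ : Finset (Fin w)).card := by simp
        _ ≤ _ := Finset.card_le_card_of_injOn (fun p => (p, K))
          (fun p _ => by simp [mem_turns, hxK]) (fun p _ q _ hpq => (Prod.mk.inj hpq).1)
    dsimp only
    rw [Nat.sub_eq_zero_of_le this, Nat.cast_zero, mul_zero]
  rw [hcost, hend, mul_zero, add_zero]
  have hrem : ∀ e ∈ turns K w T, remainingWeight K ω (fun y => w -
        ((turns K w T).filter fun e' => T e'.1 e'.2 ≤ T e.1 e.2 ∧ y ≤ e'.2).card) ≤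
      ∑ p, ∑ x ∈ Finset.range (K + 1), if T e.1 e.2 < T p x then ω x else 0 := by
    intro e he
    rw [Finset.sum_comm]
    refine Finset.sum_le_sum fun x hx => ?_
    have hxK : x ≤ K := by simpa [Nat.lt_succ_iff] using hx
    have h1 := h.card_hit_le he hxK
    have h2 := Finset.card_filter_add_card_filter_not (s := (Finset.univ : Finset (Fin w)))
      (fun p => T p x ≤ T e.1 e.2)
    simp only [not_le, Finset.card_univ, Fintype.card_fin] at h2
    rw [← Finset.sum_filter, Finset.sum_const, nsmul_eq_mul, mul_comm]
    refine mul_le_mul_of_nonneg_right ?_ (hω x)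
    rw [Nat.cast_le]
    dsimp only
    omega
  calc 2 * ∑ e ∈ turns K w T, n e.2 * remainingWeight K ω (fun y => w -
        ((turns K w T).filter fun e' => T e'.1 e'.2 ≤ T e.1 e.2 ∧ y ≤ e'.2).card)
      ≤ 2 * ∑ e ∈ turns K w T, n e.2 *
        ∑ p, ∑ x ∈ Finset.range (K + 1), (if T e.1 e.2 < T p x then ω x else 0) := by
        gcongr with e he
        · exact (h.pos _).le
        · exact hrem e he
    _ = ∑ p, ∑ x ∈ Finset.range (K + 1), ω x * (2 *
          ∑ e ∈ (turns K w T).filter (fun e => T e.1 e.2 < T p x), n e.2) := by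
        simp only [Finset.mul_sum]
        rw [Finset.sum_comm]
        refine Finset.sum_congr rfl fun p _ => ?_
        rw [Finset.sum_comm]
        refine Finset.sum_congr rfl fun x _ => ?_
        rw [Finset.sum_filter]
        refine Finset.sum_congr rfl fun e _ => ?_
        split_ifs
        · ring
        · ring
    _ ≤ _ := by
        refine Finset.sum_le_sum fun p _ => Finset.sum_le_sum fun x hx => ?_
        have hxK : x ≤ K := by simpa [Nat.lt_succ_iff] using hx
        exact mul_le_mul_of_nonneg_left (h.sum_turns_le p hxK) (hω x)

end IsHittingTimes

/-! ### Trajectories -/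

namespace Trajectory

variable {w : ℕ}

lemma abs_pos_sub_le (γ : Trajectory w) (s t : ℝ≥0) (p : Fin w) :
    |γ.pos t p - γ.pos s p| ≤ |(t : ℝ) - s| :=
  (Finset.single_le_sum (f := fun p => |γ.pos t p - γ.pos s p|) (fun _ _ => abs_nonneg _)
    (Finset.mem_univ p)).trans (γ.speed s t)

lemma continuous_pos (γ : Trajectory w) (p : Fin w) : Continuous fun t => γ.pos t p := by
  refine (LipschitzWith.of_dist_le_mul (K := 1) fun s t => ?_).continuous
  rw [NNReal.coe_one, one_mul, Real.dist_eq, NNReal.dist_eq]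
  exact γ.abs_pos_sub_le t s p

lemma exists_pos_eq (γ : Trajectory w) {p : Fin w} {n : ℝ} (hn : 0 ≤ n) {s : ℝ≥0}
    (h : n ≤ γ.pos s p) : ∃ t ≤ s, γ.pos t p = n := by
  obtain ⟨t, ht, h'⟩ := intermediate_value_Icc zero_le (γ.continuous_pos p).continuousOn
    ⟨(γ.start p).le.trans hn, h⟩
  exact ⟨t, ht.2, h'⟩

lemma cost_le (γ : Trajectory w) {p : Fin w} {n : ℝ} {t : ℝ≥0} (h : γ.pos t p = n) :
    γ.cost p n ≤ t :=
  iInf₂_le t h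

lemma exists_cost_eq (γ : Trajectory w) {p : Fin w} {n : ℝ} (h : γ.cost p n ≠ ⊤) :
    ∃ t : ℝ≥0, γ.pos t p = n ∧ γ.cost p n = t := by
  have hne : {t : ℝ≥0 | γ.pos t p = n}.Nonempty := by
    by_contra hcon
    rw [Set.not_nonempty_iff_eq_empty, Set.eq_empty_iff_forall_notMem] at hcon
    exact h (iInf₂_eq_top.2 fun t ht => absurd ht (hcon t))
  have hcl : IsClosed {t : ℝ≥0 | γ.pos t p = n} :=
    isClosed_eq (γ.continuous_pos p) continuous_const
  have hmem := hcl.csInf_mem hne (OrderBot.bddBelow _)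
  refine ⟨sInf {t : ℝ≥0 | γ.pos t p = n}, hmem, le_antisymm (γ.cost_le hmem) ?_⟩
  exact le_iInf₂ fun t ht => ENNReal.coe_le_coe.2 (csInf_le (OrderBot.bddBelow _) ht)

lemma cost_le_iff (γ : Trajectory w) {p : Fin w} {n : ℝ} (hn : 0 ≤ n) (s : ℝ≥0) :
    γ.cost p n ≤ s ↔ ∃ t ≤ s, n ≤ γ.pos t p := by
  constructor
  · intro h
    obtain ⟨t, ht, hc⟩ := γ.exists_cost_eq (ne_top_of_le_ne_top ENNReal.coe_ne_top h)
    exact ⟨t, ENNReal.coe_le_coe.1 (hc ▸ h), ht.ge⟩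
  · rintro ⟨t, hts, ht⟩
    obtain ⟨u, hu, h⟩ := γ.exists_pos_eq hn ht
    exact (γ.cost_le h).trans (ENNReal.coe_le_coe.2 (hu.trans hts))

lemma measurable_pos_apply (t : ℝ≥0) (p : Fin w) : Measurable fun γ : Trajectory w => γ.pos t p :=
  (measurable_pi_apply p).comp ((measurable_pi_apply t).comp (comap_measurable _))

/-- A countable description, needed for measurability. The slack `1 / (k + 1)` makes the condition
open, so that dense times suffice; compactness of `[0, s]` removes it again. -/
lemma cost_le_iff_forall (γ : Trajectory w) {p : Fin w} {n : ℝ} (hn : 0 ≤ n) (s : ℝ≥0) :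
    γ.cost p n ≤ s ↔ ∀ k : ℕ, ∃ i : ℕ,
      n - 1 / ((k : ℝ) + 1) < γ.pos (min s (TopologicalSpace.denseSeq ℝ≥0 i)) p := by
  rw [γ.cost_le_iff hn]
  constructor
  · rintro ⟨t, hts, ht⟩ k
    have hopen : IsOpen {u : ℝ≥0 | n - 1 / ((k : ℝ) + 1) < γ.pos (min s u) p} :=
      isOpen_lt continuous_const ((γ.continuous_pos p).comp (continuous_const.min continuous_id))
    have hne : {u : ℝ≥0 | n - 1 / ((k : ℝ) + 1) < γ.pos (min s u) p}.Nonempty := by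
      refine ⟨t, ?_⟩
      rw [Set.mem_ofPred_eq, min_eq_right hts]
      have : (0 : ℝ) < 1 / ((k : ℝ) + 1) := by positivity
      linarith
    exact (TopologicalSpace.denseRange_denseSeq ℝ≥0).exists_mem_open hopen hne
  · intro h
    obtain ⟨t, ht, hmax⟩ := isCompact_Icc.exists_isMaxOn ⟨0, Set.left_mem_Icc.2 zero_le⟩
      (γ.continuous_pos p).continuousOn
    refine ⟨t, ht.2, ?_⟩
    by_contra hlt
    obtain ⟨k, hk⟩ := exists_nat_one_div_lt (sub_pos.2 (not_le.1 hlt))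
    obtain ⟨i, hi⟩ := h k
    have : γ.pos (min s (TopologicalSpace.denseSeq ℝ≥0 i)) p ≤ γ.pos t p :=
      hmax ⟨zero_le, min_le_left _ _⟩
    linarith

lemma measurable_cost (p : Fin w) {n : ℝ} (hn : 0 ≤ n) :
    Measurable fun γ : Trajectory w => γ.cost p n := by
  refine measurable_of_Iic fun s => ?_
  rcases eq_or_ne s ⊤ with rfl | hs
  · simp
  lift s to ℝ≥0 using hs
  have : (fun γ : Trajectory w => γ.cost p n) ⁻¹' Set.Iic (s : ℝ≥0∞) = ⋂ k : ℕ, ⋃ i : ℕ,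
      {γ | n - 1 / ((k : ℝ) + 1) < γ.pos (min s (TopologicalSpace.denseSeq ℝ≥0 i)) p} := by
    ext γ
    simp only [Set.mem_preimage, Set.mem_Iic, Set.mem_iInter, Set.mem_iUnion, Set.mem_ofPred_eq]
    exact γ.cost_le_iff_forall hn s
  rw [this]
  exact MeasurableSet.iInter fun k => MeasurableSet.iUnion fun i =>
    measurableSet_lt measurable_const (measurable_pos_apply _ _)

lemma le_cost (γ : Trajectory w) (p : Fin w) (n : ℝ) : ENNReal.ofReal n ≤ γ.cost p n := by
  refine le_iInf₂ fun t ht => ?_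
  have := γ.abs_pos_sub_le 0 t p
  rw [ht, γ.start, NNReal.coe_zero, sub_zero, sub_zero, NNReal.abs_eq] at this
  rw [← ENNReal.ofReal_coe_nnreal]
  exact ENNReal.ofReal_le_ofReal ((le_abs_self n).trans this)

lemma isHittingTimes (γ : Trajectory w) {n : ℕ → ℝ} (hn : ∀ x, 0 < n x) (hn' : StrictMono n)
    {K : ℕ} (hfin : ∀ p, ∀ x ≤ K, γ.cost p (n x) ≠ ⊤) :
    IsHittingTimes K w n fun p x => (γ.cost p (n x)).toReal where
  pos := hn
  le p x hx := (ENNReal.ofReal_le_iff_le_toReal (hfin p x hx)).1 (γ.le_cost p (n x))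
  mono p x y hxy hy := by
    obtain ⟨t, ht, hc⟩ := γ.exists_cost_eq (hfin p y hy)
    obtain ⟨s, hs, h⟩ := γ.exists_pos_eq (hn x).le ((hn' hxy).le.trans ht.ge)
    have hst : s ≠ t := by
      rintro rfl
      exact (hn' hxy).ne (h.symm.trans ht)
    have h1 : (γ.cost p (n x)).toReal ≤ s :=
      ENNReal.toReal_le_of_le_ofReal s.2 (by
        rw [ENNReal.ofReal_coe_nnreal]
        exact γ.cost_le h)
    rw [hc, ENNReal.coe_toReal]
    exact h1.trans_lt (NNReal.coe_lt_coe.2 (lt_of_le_of_ne hs hst))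
  switch p q x y hpq hx hy hle := by
    obtain ⟨s, hs, hc⟩ := γ.exists_cost_eq (hfin p x hx)
    obtain ⟨t, ht, hc'⟩ := γ.exists_cost_eq (hfin q y hy)
    rw [hc, hc', ENNReal.coe_toReal, ENNReal.coe_toReal] at hle ⊢
    have h1 : γ.pos s q = 0 := by
      rcases γ.one_path s p q hpq with h | h
      · exact absurd (hs.symm.trans h) (hn x).ne'
      · exact h
    have h2 : γ.pos t p = 0 := by
      rcases γ.one_path t p q hpq with h | h
      · exact h
      · exact absurd (ht.symm.trans h) (hn y).ne'
    have h3 := γ.speed s t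
    have h4 : |γ.pos t p - γ.pos s p| + |γ.pos t q - γ.pos s q| ≤
        ∑ p, |γ.pos t p - γ.pos s p| := by
      rw [← Finset.sum_pair (f := fun p => |γ.pos t p - γ.pos s p|) hpq]
      exact Finset.sum_le_sum_of_subset_of_nonneg (Finset.subset_univ _)
        fun _ _ _ => abs_nonneg _
    rw [h1, h2, hs, ht, zero_sub, sub_zero, abs_neg, abs_of_pos (hn x), abs_of_pos (hn y)] at h4
    rw [abs_of_nonneg (sub_nonneg.2 hle)] at h3
    linarith

end Trajectory

/-! ### The lower bound -/

/-- The weighted cost of every trajectory is large. -/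
lemma Trajectory.le_sum_cost {w : ℕ} (hw : 1 ≤ w) {r ρ : ℝ} (hr : IsCriticalRate w r)
    (hρ : 1 < ρ) (K : ℕ) (γ : Trajectory w) :
    ENNReal.ofReal (∑ _p : Fin w, ∑ x ∈ Finset.range (K + 1), gridWeight ρ K x * ρ ^ x +
        2 * (ρ⁻¹ * (Real.log ρ * (rateObjective w r * (K + 1)) - w * w))) ≤
      ∑ p, ∑ x ∈ Finset.range (K + 1), ENNReal.ofReal (gridWeight ρ K x) * γ.cost p (ρ ^ x) := by
  have hρ0 : 0 < ρ := by linarith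
  have hr0 : 0 < r := by linarith [hr.1]
  have hω := gridWeight_pos hρ K
  by_cases hfin : ∀ p, ∀ x ≤ K, γ.cost p (ρ ^ x) ≠ ⊤
  · have hT := γ.isHittingTimes (fun x => pow_pos hρ0 x) (pow_right_strictMono₀ hρ) hfin
    have hM := rateObjective_nonneg w hr.1
    have hlog := Real.log_pos hρ
    -- The chosen `Λ` turns the size condition of `le_stageCost` into an equality.
    obtain ⟨L, hL, hle⟩ := hT.exists_stageCost_le (fun x => (hω x).le)
      (ρ⁻¹ * (Real.log ρ * (rateObjective w r * (K + 1)) * ρ ^ K))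
    have hcost := le_stageCost hρ hr0 hw hr.2 (by positivity)
      (Λ := ρ⁻¹ * (Real.log ρ * (rateObjective w r * (K + 1)) * ρ ^ K))
      (by rw [mul_inv_cancel_left₀ hρ0.ne', hr.sum_eq]) L hL
    rw [← hr.sum_eq, ← div_le_iff₀' hρ0, div_eq_inv_mul] at hcost
    have hrhs : ∑ p, ∑ x ∈ Finset.range (K + 1),
          ENNReal.ofReal (gridWeight ρ K x) * γ.cost p (ρ ^ x) =
        ENNReal.ofReal (∑ p, ∑ x ∈ Finset.range (K + 1),
          gridWeight ρ K x * (γ.cost p (ρ ^ x)).toReal) := by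
      have hnn : ∀ p x, 0 ≤ gridWeight ρ K x * (γ.cost p (ρ ^ x)).toReal := fun p x =>
        mul_nonneg (hω x).le ENNReal.toReal_nonneg
      rw [ENNReal.ofReal_sum_of_nonneg fun p _ => Finset.sum_nonneg fun x _ => hnn p x]
      refine Finset.sum_congr rfl fun p _ => ?_
      rw [ENNReal.ofReal_sum_of_nonneg fun x _ => hnn p x]
      refine Finset.sum_congr rfl fun x hx => ?_
      rw [ENNReal.ofReal_mul (hω x).le,
        ENNReal.ofReal_toReal (hfin p x (Nat.lt_succ_iff.1 (Finset.mem_range.1 hx)))]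
    rw [hrhs]
    refine ENNReal.ofReal_le_ofReal ?_
    have hsplit : ∑ p, ∑ x ∈ Finset.range (K + 1),
          gridWeight ρ K x * ((γ.cost p (ρ ^ x)).toReal - ρ ^ x) =
        ∑ p, ∑ x ∈ Finset.range (K + 1), gridWeight ρ K x * (γ.cost p (ρ ^ x)).toReal -
          ∑ _p : Fin w, ∑ x ∈ Finset.range (K + 1), gridWeight ρ K x * ρ ^ x := by
      simp only [mul_sub, Finset.sum_sub_distrib]
    rw [hsplit] at hle
    linarith
  · push Not at hfin
    obtain ⟨p, x, hx, htop⟩ := hfin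
    refine le_of_le_of_eq le_top (Eq.symm ?_)
    refine ENNReal.sum_eq_top.2 ⟨p, Finset.mem_univ p, ENNReal.sum_eq_top.2
      ⟨x, Finset.mem_range.2 (by omega), ?_⟩⟩
    rw [htop]
    exact ENNReal.mul_top (ENNReal.ofReal_pos.2 (hω x)).ne'

lemma RandomizedAlgorithm.le_expectedCost {w : ℕ} (A : RandomizedAlgorithm w) (p : Fin w)
    (n : ℝ) : ENNReal.ofReal n ≤ RandomizedAlgorithm.expectedCost A p n := by
  calc ENNReal.ofReal n = ∫⁻ _, ENNReal.ofReal n ∂(A : Measure (Trajectory w)) := by simp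
    _ ≤ _ := lintegral_mono fun γ => γ.le_cost p n

lemma RandomizedAlgorithm.HasCompetitiveRatio.le_sum {w : ℕ} (hw : 1 ≤ w) {r ρ c : ℝ}
    (hr : IsCriticalRate w r) (hρ : 1 < ρ) {A : RandomizedAlgorithm w} {g : ℝ → ℝ}
    (hA : ∀ (p : Fin w) (n : ℝ), 0 < n →
      RandomizedAlgorithm.expectedCost A p n ≤ ENNReal.ofReal (c * n + g n)) (K : ℕ) :
    2 * (ρ⁻¹ * (Real.log ρ * (rateObjective w r * (K + 1)) - w * w)) ≤
      w * ∑ x ∈ Finset.range (K + 1), gridWeight ρ K x * (c * ρ ^ x + g (ρ ^ x) - ρ ^ x) := by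
  have hρ0 : 0 < ρ := by linarith
  have hω := gridWeight_pos hρ K
  -- `ENNReal.ofReal` would truncate a negative bound to `0`; this is excluded since every cost is
  -- at least the distance.
  have hpos : ∀ x : ℕ, 0 ≤ c * ρ ^ x + g (ρ ^ x) := by
    intro x
    have hx := pow_pos hρ0 x
    have h := (RandomizedAlgorithm.le_expectedCost A ⟨0, hw⟩ (ρ ^ x)).trans (hA ⟨0, hw⟩ _ hx)
    have h' := (ENNReal.ofReal_pos.2 hx).trans_le h
    exact (ENNReal.ofReal_pos.1 h').le
  have h1 : ∫⁻ γ, ∑ p, ∑ x ∈ Finset.range (K + 1),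
        ENNReal.ofReal (gridWeight ρ K x) * γ.cost p (ρ ^ x) ∂(A : Measure (Trajectory w)) =
      ∑ p, ∑ x ∈ Finset.range (K + 1), ENNReal.ofReal (gridWeight ρ K x) *
        RandomizedAlgorithm.expectedCost A p (ρ ^ x) := by
    have hm : ∀ (p : Fin w) (x : ℕ), Measurable fun γ : Trajectory w => γ.cost p (ρ ^ x) :=
      fun p x => Trajectory.measurable_cost p (pow_pos hρ0 x).le
    rw [lintegral_finsetSum _ fun p _ => Finset.measurable_sum _ fun x _ => (hm p x).const_mul _]
    refine Finset.sum_congr rfl fun p _ => ?_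
    rw [lintegral_finsetSum _ fun x _ => (hm p x).const_mul _]
    refine Finset.sum_congr rfl fun x _ => ?_
    rw [lintegral_const_mul _ (hm p x), RandomizedAlgorithm.expectedCost]
  have h2 : ENNReal.ofReal (∑ _p : Fin w, ∑ x ∈ Finset.range (K + 1), gridWeight ρ K x * ρ ^ x +
        2 * (ρ⁻¹ * (Real.log ρ * (rateObjective w r * (K + 1)) - w * w))) ≤
      ENNReal.ofReal (∑ _p : Fin w, ∑ x ∈ Finset.range (K + 1),
        gridWeight ρ K x * (c * ρ ^ x + g (ρ ^ x))) := by
    have hnn : ∀ x, 0 ≤ gridWeight ρ K x * (c * ρ ^ x + g (ρ ^ x)) := fun x =>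
      mul_nonneg (hω x).le (hpos x)
    calc _ = ∫⁻ _, ENNReal.ofReal (∑ _p : Fin w, ∑ x ∈ Finset.range (K + 1),
              gridWeight ρ K x * ρ ^ x +
            2 * (ρ⁻¹ * (Real.log ρ * (rateObjective w r * (K + 1)) - w * w)))
            ∂(A : Measure (Trajectory w)) := by simp
      _ ≤ _ := lintegral_mono fun γ => γ.le_sum_cost hw hr hρ K
      _ = _ := h1
      _ ≤ ∑ _p : Fin w, ∑ x ∈ Finset.range (K + 1), ENNReal.ofReal (gridWeight ρ K x) *
            ENNReal.ofReal (c * ρ ^ x + g (ρ ^ x)) := by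
          gcongr with p _ x _
          exact hA p _ (pow_pos hρ0 x)
      _ = _ := by
          rw [ENNReal.ofReal_sum_of_nonneg fun p _ => Finset.sum_nonneg fun x _ => hnn x]
          refine Finset.sum_congr rfl fun p _ => ?_
          rw [ENNReal.ofReal_sum_of_nonneg fun x _ => hnn x]
          exact Finset.sum_congr rfl fun x _ => (ENNReal.ofReal_mul (hω x).le).symm
  rw [ENNReal.ofReal_le_ofReal_iff (Finset.sum_nonneg fun p _ => Finset.sum_nonneg fun x _ =>
    mul_nonneg (hω x).le (hpos x))] at h2
  simp only [Finset.sum_const, Finset.card_univ, Fintype.card_fin, nsmul_eq_mul] at h2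
  simp only [mul_sub (gridWeight ρ K _) _ (ρ ^ _), Finset.sum_sub_distrib]
  rw [mul_sub]
  linarith

/-- Weight times distance is `1 - ρ⁻¹` at every level below `K`, so the weighted bound is
essentially a Cesàro mean, in which the `o(n)` term vanishes. The last level and the loss `w * w`
stay bounded and disappear after division by `K`. -/
lemma RandomizedAlgorithm.HasCompetitiveRatio.le_of_grid {w : ℕ} (hw : 1 ≤ w) {r ρ c : ℝ}
    (hr : IsCriticalRate w r) (hρ : 1 < ρ) {A : RandomizedAlgorithm w}
    (hA : RandomizedAlgorithm.HasCompetitiveRatio A c) :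
    2 * (ρ⁻¹ * (Real.log ρ * rateObjective w r)) ≤ w * ((1 - ρ⁻¹) * (c - 1)) := by
  obtain ⟨g, hg, hA⟩ := hA
  have hρ0 : 0 < ρ := by linarith
  let b : ℕ → ℝ := fun x => c - 1 + g (ρ ^ x) / ρ ^ x
  have hb : Tendsto b atTop (nhds (c - 1)) := by
    have h1 := (hg.tendsto_div_nhds_zero).comp (tendsto_pow_atTop_atTop_of_one_lt hρ)
    simpa using tendsto_const_nhds.add h1
  have hces := hb.cesaro
  have hinv : Tendsto (fun K : ℕ => ((K : ℝ))⁻¹) atTop (nhds 0) :=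
    tendsto_inv_atTop_nhds_zero_nat
  have hsum : ∀ K : ℕ, ∑ x ∈ Finset.range (K + 1),
      gridWeight ρ K x * (c * ρ ^ x + g (ρ ^ x) - ρ ^ x) =
      (1 - ρ⁻¹) * ∑ x ∈ Finset.range K, b x + b K := by
    intro K
    rw [Finset.sum_range_succ, Finset.mul_sum]
    congr 1
    · refine Finset.sum_congr rfl fun x hx => ?_
      rw [gridWeight, if_pos (Finset.mem_range.1 hx)]
      simp only [b]
      field_simp
      ring
    · rw [gridWeight, if_neg (lt_irrefl K)]
      simp only [b]
      field_simp
      ring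
  have hle : ∀ K : ℕ, (K : ℝ)⁻¹ *
      (2 * (ρ⁻¹ * (Real.log ρ * (rateObjective w r * (K + 1)) - w * w))) ≤
      (K : ℝ)⁻¹ * (w * ((1 - ρ⁻¹) * ∑ x ∈ Finset.range K, b x + b K)) := by
    intro K
    rw [← hsum K]
    exact mul_le_mul_of_nonneg_left (le_sum hw hr hρ hA K) (by positivity)
  have hone : Tendsto (fun K : ℕ => (K : ℝ)⁻¹ * (K + 1)) atTop (nhds 1) := by
    have : Tendsto (fun K : ℕ => 1 + (K : ℝ)⁻¹) atTop (nhds (1 + 0)) :=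
      tendsto_const_nhds.add hinv
    rw [add_zero] at this
    refine this.congr' ?_
    filter_upwards [eventually_gt_atTop 0] with K hK
    have : (K : ℝ) ≠ 0 := by positivity
    field_simp
  have hlim1 : Tendsto (fun K : ℕ => (K : ℝ)⁻¹ *
      (2 * (ρ⁻¹ * (Real.log ρ * (rateObjective w r * (K + 1)) - w * w)))) atTop
      (nhds (2 * (ρ⁻¹ * (Real.log ρ * rateObjective w r)))) := by
    have : Tendsto (fun K : ℕ => 2 * (ρ⁻¹ * (Real.log ρ * (rateObjective w r *
        ((K : ℝ)⁻¹ * (K + 1))) - (K : ℝ)⁻¹ * (w * w)))) atTop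
        (nhds (2 * (ρ⁻¹ * (Real.log ρ * (rateObjective w r * 1) - 0 * (w * w))))) :=
      ((((hone.const_mul _).const_mul _).sub (hinv.mul_const _)).const_mul _).const_mul _
    rw [mul_one, zero_mul, sub_zero] at this
    refine this.congr fun K => ?_
    ring
  have hlim2 : Tendsto (fun K : ℕ => (K : ℝ)⁻¹ *
      (w * ((1 - ρ⁻¹) * ∑ x ∈ Finset.range K, b x + b K))) atTop
      (nhds (w * ((1 - ρ⁻¹) * (c - 1)))) := by
    have : Tendsto (fun K : ℕ => w * ((1 - ρ⁻¹) * ((K : ℝ)⁻¹ * ∑ x ∈ Finset.range K, b x) +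
        (K : ℝ)⁻¹ * b K)) atTop (nhds (w * ((1 - ρ⁻¹) * (c - 1) + 0 * (c - 1)))) :=
      ((hces.const_mul _).add (hinv.mul hb)).const_mul _
    rw [zero_mul, add_zero] at this
    refine this.congr fun K => ?_
    ring
  exact le_of_tendsto_of_tendsto' hlim1 hlim2 hle

theorem RandomizedAlgorithm.HasCompetitiveRatio.barR_le {w : ℕ} (hw : 1 ≤ w) {r c : ℝ}
    (hr : IsCriticalRate w r) {A : RandomizedAlgorithm w}
    (hA : RandomizedAlgorithm.HasCompetitiveRatio A c) : barR w r ≤ c := by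
  have hM := rateObjective_nonneg w hr.1
  have key : ∀ ρ : ℝ, 1 < ρ → 2 * rateObjective w r ≤ ρ * (w * (c - 1)) := by
    intro ρ hρ
    have hρ0 : 0 < ρ := by linarith
    have h1 := hA.le_of_grid hw hr hρ
    -- `log ρ ≥ 1 - ρ⁻¹` lets the positive factor `1 - ρ⁻¹` cancel; only a factor `ρ` is lost, which
    -- tends to `1`.
    have h2 := Real.one_sub_inv_le_log_of_pos hρ0
    have h3 : 0 < 1 - ρ⁻¹ := sub_pos.2 (inv_lt_one_of_one_lt₀ hρ)
    have h4 : (1 - ρ⁻¹) * (2 * (ρ⁻¹ * rateObjective w r)) ≤ (1 - ρ⁻¹) * (w * (c - 1)) := by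
      have := mul_le_mul_of_nonneg_right h2
        (show 0 ≤ 2 * (ρ⁻¹ * rateObjective w r) by positivity)
      linarith
    have h5 := mul_le_mul_of_nonneg_left (le_of_mul_le_mul_left h4 h3) hρ0.le
    calc 2 * rateObjective w r = ρ * (2 * (ρ⁻¹ * rateObjective w r)) := by field_simp
      _ ≤ _ := h5
  have hlim : Tendsto (fun ρ : ℝ => ρ * (w * (c - 1))) (nhdsWithin 1 (Set.Ioi 1))
      (nhds (1 * (w * (c - 1)))) :=
    (tendsto_id.mul_const _).mono_left nhdsWithin_le_nhds
  have h := ge_of_tendsto hlim (eventually_nhdsWithin_of_forall fun ρ hρ => key ρ hρ)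
  have hw0 : (0 : ℝ) < w := by exact_mod_cast hw
  rw [barR, div_mul_eq_mul_div, ← le_sub_iff_add_le', div_le_iff₀ hw0]
  linarith

/-! ### Trajectories that proceed in stages -/

/-- The time at which stage `i` begins. -/
def stageStart (h : ℕ → ℝ) (i : ℕ) : ℝ := ∑ j ∈ Finset.range i, 2 * h j

/-- The distance from the origin at time `t` in stage `i`, and `0` outside this stage. -/
def stageHeight (h : ℕ → ℝ) (i : ℕ) (t : ℝ) : ℝ :=
  max 0 (min (t - stageStart h i) (stageStart h i + 2 * h i - t))

/-- The position at time `t`, for stages of length at least `1`. -/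
def stagedPos {w : ℕ} (a : ℕ → Fin w) (h : ℕ → ℝ) (t : ℝ≥0) (p : Fin w) : ℝ :=
  ∑ i ∈ Finset.range (⌈t⌉₊ + 1), if a i = p then stageHeight h i t else 0

section

variable {w : ℕ} {a : ℕ → Fin w} {h : ℕ → ℝ}

lemma stageStart_succ (h : ℕ → ℝ) (i : ℕ) : stageStart h (i + 1) = stageStart h i + 2 * h i :=
  Finset.sum_range_succ _ _

lemma monotone_stageStart (hh : ∀ i, 1 ≤ h i) : Monotone (stageStart h) := by
  refine monotone_nat_of_le_succ fun i => ?_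
  rw [stageStart_succ]
  linarith [hh i]

/-- By time `t` only stages with index at most `⌈t⌉₊` can have begun, so the finite sum in
`stagedPos` omits nothing. -/
lemma le_stageStart (hh : ∀ i, 1 ≤ h i) (i : ℕ) : (i : ℝ) ≤ stageStart h i := by
  induction i with
  | zero => simp [stageStart]
  | succ i ih =>
    rw [stageStart_succ]
    push_cast
    linarith [hh i]

lemma exists_stage (hh : ∀ i, 1 ≤ h i) (t : ℝ≥0) :
    ∃ i, stageStart h i ≤ t ∧ t ≤ stageStart h (i + 1) := by
  classical
  have hex : ∃ N, (t : ℝ) ≤ stageStart h (N + 1) := by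
    refine ⟨⌈(t : ℝ)⌉₊, ?_⟩
    have h1 := Nat.le_ceil (t : ℝ)
    have h2 := le_stageStart hh (⌈(t : ℝ)⌉₊ + 1)
    push_cast at h2
    linarith
  refine ⟨Nat.find hex, ?_, Nat.find_spec hex⟩
  rcases hN : Nat.find hex with _ | N
  · simp [stageStart]
  · exact (not_le.1 (Nat.find_min hex (m := N) (by omega))).le

lemma stagedPos_eq (a : ℕ → Fin w) (hh : ∀ i, 1 ≤ h i) {i : ℕ} {t : ℝ≥0}
    (h1 : stageStart h i ≤ t) (h2 : t ≤ stageStart h (i + 1)) :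
    stagedPos a h t = Pi.single (a i) (min (t - stageStart h i) (stageStart h i + 2 * h i - t)) := by
  funext p
  have hmem : i ∈ Finset.range (⌈t⌉₊ + 1) := by
    have h3 : (i : ℝ) ≤ t := (le_stageStart hh i).trans h1
    have h4 : (i : ℝ≥0) ≤ t := by exact_mod_cast h3
    have h5 : i ≤ ⌈t⌉₊ := by exact_mod_cast h4.trans (Nat.le_ceil t)
    simpa [Nat.lt_succ_iff] using h5
  rw [stagedPos, Finset.sum_eq_single_of_mem i hmem]
  · have h3 : stageHeight h i t = min (t - stageStart h i) (stageStart h i + 2 * h i - t) := by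
      rw [stageStart_succ] at h2
      exact max_eq_right (le_min (by linarith) (by linarith))
    by_cases hp : a i = p
    · subst hp
      simp [h3]
    · rw [if_neg hp, Pi.single_eq_of_ne (Ne.symm hp)]
  · intro j _ hj
    have : stageHeight h j t = 0 := by
      rw [stageHeight, ← stageStart_succ]
      refine max_eq_left ?_
      rcases lt_or_gt_of_ne hj with hlt | hgt
      · have := monotone_stageStart hh (show j + 1 ≤ i from hlt)
        exact (min_le_right _ _).trans (by linarith)
      · have := monotone_stageStart hh (show i + 1 ≤ j from hgt)
        exact (min_le_left _ _).trans (by linarith)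
    rw [this, ite_self]

lemma sum_abs_single_sub_le (p q : Fin w) (x y : ℝ) :
    ∑ j, |(Pi.single p x : Fin w → ℝ) j - (Pi.single q y : Fin w → ℝ) j| ≤ |x| + |y| := by
  calc ∑ j, |(Pi.single p x : Fin w → ℝ) j - (Pi.single q y : Fin w → ℝ) j|
      ≤ ∑ j, (|(Pi.single p x : Fin w → ℝ) j| + |(Pi.single q y : Fin w → ℝ) j|) :=
        Finset.sum_le_sum fun j _ => abs_sub _ _
    _ = |x| + |y| := by
        rw [Finset.sum_add_distrib]
        congr 1
        · rw [Finset.sum_eq_single_of_mem p (Finset.mem_univ p)]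
          · simp
          · intro j _ hj
            simp [Pi.single_eq_of_ne hj]
        · rw [Finset.sum_eq_single_of_mem q (Finset.mem_univ q)]
          · simp
          · intro j _ hj
            simp [Pi.single_eq_of_ne hj]

lemma sum_abs_single_sub_same (p : Fin w) (x y : ℝ) :
    ∑ j, |(Pi.single p x : Fin w → ℝ) j - (Pi.single p y : Fin w → ℝ) j| = |x - y| := by
  rw [Finset.sum_eq_single_of_mem p (Finset.mem_univ p)]
  · simp
  · intro j _ hj
    simp [Pi.single_eq_of_ne hj]

lemma stagedPos_speed (a : ℕ → Fin w) (hh : ∀ i, 1 ≤ h i) {s t : ℝ≥0} (hst : s ≤ t) :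
    ∑ p, |stagedPos a h t p - stagedPos a h s p| ≤ (t : ℝ) - s := by
  obtain ⟨i, hi1, hi2⟩ := exists_stage hh s
  obtain ⟨j, hj1, hj2⟩ := exists_stage hh t
  have hst' : (s : ℝ) ≤ t := by exact_mod_cast hst
  rw [stagedPos_eq a hh hi1 hi2, stagedPos_eq a hh hj1 hj2]
  rw [stageStart_succ] at hi2 hj2
  have hsame : ∀ i, |min ((t : ℝ) - stageStart h i) (stageStart h i + 2 * h i - t) -
      min ((s : ℝ) - stageStart h i) (stageStart h i + 2 * h i - s)| ≤ (t : ℝ) - s := by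
    intro i
    refine (abs_min_sub_min_le_max _ _ _ _).trans (max_le ?_ ?_)
    · rw [sub_sub_sub_cancel_right, abs_of_nonneg (by linarith)]
    · rw [sub_sub_sub_cancel_left, abs_of_nonpos (by linarith), neg_sub]
  rcases lt_trichotomy i j with hij | hij | hij
  · have h1 := monotone_stageStart hh (show i + 1 ≤ j from hij)
    rw [stageStart_succ] at h1
    refine (sum_abs_single_sub_le _ _ _ _).trans ?_
    rw [abs_of_nonneg (le_min (by linarith) (by linarith)),
      abs_of_nonneg (le_min (by linarith) (by linarith))]
    have h2 := min_le_left ((t : ℝ) - stageStart h j) (stageStart h j + 2 * h j - t)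
    have h3 := min_le_right ((s : ℝ) - stageStart h i) (stageStart h i + 2 * h i - s)
    linarith
  · subst hij
    rw [sum_abs_single_sub_same]
    exact hsame i
  -- At a boundary two stages contain the same time. Here `s = t` is such a boundary and both
  -- heights are `0`.
  · have h1 := monotone_stageStart hh (show j + 1 ≤ i from hij)
    rw [stageStart_succ] at h1
    have h2 : (t : ℝ) = s := by linarith
    have h3 : (s : ℝ) = stageStart h i := by linarith
    have h4 : (t : ℝ) = stageStart h j + 2 * h j := by linarith
    refine (sum_abs_single_sub_le _ _ _ _).trans ?_
    rw [abs_of_nonneg (le_min (by linarith) (by linarith)),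
      abs_of_nonneg (le_min (by linarith) (by linarith))]
    have h5 := min_le_right ((t : ℝ) - stageStart h j) (stageStart h j + 2 * h j - t)
    have h6 := min_le_left ((s : ℝ) - stageStart h i) (stageStart h i + 2 * h i - s)
    linarith

/-- The robot explores path `a i` up to distance `h i` and returns, for `i = 0, 1, 2, …`. -/
def stagedTrajectory (a : ℕ → Fin w) (h : ℕ → ℝ) (hh : ∀ i, 1 ≤ h i) : Trajectory w where
  pos := stagedPos a h
  nonneg t p := Finset.sum_nonneg fun i _ => by
    split_ifs
    · exact le_max_left _ _
    · exact le_rfl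
  one_path t p q hpq := by
    obtain ⟨i, h1, h2⟩ := exists_stage hh t
    rw [stagedPos_eq a hh h1 h2]
    by_cases hp : p = a i
    · right
      rw [Pi.single_eq_of_ne (hp ▸ hpq.symm)]
    · left
      rw [Pi.single_eq_of_ne hp]
  start p := by
    have h1 : stageStart h 0 = 0 := by simp [stageStart]
    have h2 := hh 0
    rw [stagedPos_eq a hh (i := 0) (by simp [h1]) (by
      rw [stageStart_succ, h1, NNReal.coe_zero]
      linarith), h1]
    have : min (((0 : ℝ≥0) : ℝ) - 0) (0 + 2 * h 0 - ((0 : ℝ≥0) : ℝ)) = 0 := by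
      rw [NNReal.coe_zero]
      exact (min_eq_left (by linarith)).trans (sub_zero 0)
    rw [this, Pi.single_zero, Pi.zero_apply]
  speed s t := by
    rcases le_total s t with hst | hst
    · rw [abs_of_nonneg (sub_nonneg.2 (NNReal.coe_le_coe.2 hst))]
      exact stagedPos_speed a hh hst
    · rw [abs_of_nonpos (sub_nonpos.2 (NNReal.coe_le_coe.2 hst)), neg_sub]
      simp only [abs_sub_comm (stagedPos a h t _)]
      exact stagedPos_speed a hh hst

lemma stagedTrajectory_executes (a : ℕ → Fin w) (hh : ∀ i, 1 ≤ h i) :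
    (stagedTrajectory a h hh).Executes a h := by
  intro i t τ h1 h2
  exact stagedPos_eq a hh h1 (h2.trans (stageStart_succ h i).ge)

lemma Trajectory.Executes.cost_le {γ : Trajectory w} (hγ : γ.Executes a h) (hh : ∀ i, 0 ≤ h i)
    {j : ℕ} {n : ℝ} (hn : 0 ≤ n) (hj : n ≤ h j) :
    γ.cost (a j) n ≤ ENNReal.ofReal (∑ i ∈ Finset.range j, 2 * h i + n) := by
  have h0 : 0 ≤ ∑ i ∈ Finset.range j, 2 * h i :=
    Finset.sum_nonneg fun i _ => mul_nonneg zero_le_two (hh i)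
  refine (γ.cost_le (t := Real.toNNReal (∑ i ∈ Finset.range j, 2 * h i + n)) ?_).trans_eq rfl
  have hcoe := Real.coe_toNNReal _ (add_nonneg h0 hn)
  rw [hγ j _ (by rw [hcoe]; linarith) (by rw [hcoe]; linarith), hcoe, Pi.single_eq_same]
  rw [min_eq_left (by linarith)]
  ring

end

/-! ### The Kao–Reif–Tate algorithm -/

/-- For uniform `σ` the index `σ⁻¹ p` is uniform: by left multiplication with transpositions the sum
does not depend on `p`, so it can be averaged over `p`. -/
lemma sum_perm_inv_apply {w : ℕ} (F : Fin w → ℝ) (p : Fin w) :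
    (w : ℝ) * ∑ σ : Equiv.Perm (Fin w), F (σ⁻¹ p) = w.factorial * ∑ q, F q := by
  have h1 : ∀ p', ∑ σ : Equiv.Perm (Fin w), F (σ⁻¹ p') = ∑ σ : Equiv.Perm (Fin w), F (σ⁻¹ p) := by
    intro p'
    refine Fintype.sum_equiv (Equiv.mulLeft (Equiv.swap p p')) _ _ fun σ => ?_
    simp [mul_inv_rev, Equiv.Perm.mul_apply]
  calc (w : ℝ) * ∑ σ : Equiv.Perm (Fin w), F (σ⁻¹ p)
      = ∑ p', ∑ σ : Equiv.Perm (Fin w), F (σ⁻¹ p') := by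
        rw [Finset.sum_congr rfl fun p' _ => h1 p', Finset.sum_const, Finset.card_univ,
          Fintype.card_fin, nsmul_eq_mul]
    _ = ∑ σ : Equiv.Perm (Fin w), ∑ p', F (σ⁻¹ p') := Finset.sum_comm
    _ = ∑ σ : Equiv.Perm (Fin w), ∑ q, F q :=
        Finset.sum_congr rfl fun σ _ => Equiv.sum_comp σ⁻¹ F
    _ = w.factorial * ∑ q, F q := by
        rw [Finset.sum_const, Finset.card_univ, Fintype.card_perm, Fintype.card_fin, nsmul_eq_mul]

section

variable {w : ℕ} [NeZero w]

/-- Replacing `ε` by `max ε 0` gives admissible lengths for every real `ε` and changes nothing on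
`[0, 1)`. -/
lemma one_le_krtLength {r : ℝ} (hr : 1 < r) (ε : ℝ) (j : ℕ) : 1 ≤ r ^ max ε 0 * r ^ j :=
  one_le_mul_of_one_le_of_one_le (Real.one_le_rpow hr.le (le_max_right _ _))
    (one_le_pow₀ hr.le)

/-- The trajectory of the Kao–Reif–Tate algorithm for the random choices `σ` and `ε`. -/
def krtTrajectory {r : ℝ} (hr : 1 < r) (σ : Equiv.Perm (Fin w)) (ε : ℝ) : Trajectory w :=
  stagedTrajectory (fun j => σ (Fin.ofNat w (j + 1))) (fun j => r ^ max ε 0 * r ^ j)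
    (one_le_krtLength hr ε)

lemma krtTrajectory_executes {r : ℝ} (hr : 1 < r) (σ : Equiv.Perm (Fin w)) {ε : ℝ} (hε : 0 ≤ ε) :
    (krtTrajectory hr σ ε).Executes (fun j => σ (Fin.ofNat w (j + 1)))
      (fun j => r ^ ε * r ^ j) := by
  have h1 : (fun j : ℕ => r ^ ε * r ^ j) = fun j => r ^ max ε 0 * r ^ j := by rw [max_eq_left hε]
  rw [h1]
  exact stagedTrajectory_executes _ (one_le_krtLength hr ε)

lemma measurable_krtTrajectory {r : ℝ} (hr : 1 < r) (σ : Equiv.Perm (Fin w)) :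
    Measurable (krtTrajectory hr σ) := by
  refine measurable_comap_iff.2 (measurable_pi_iff.2 fun t => measurable_pi_iff.2 fun p => ?_)
  have h1 : Continuous fun ε : ℝ => r ^ max ε 0 :=
    continuous_const.rpow (continuous_id.max continuous_const) fun _ => Or.inl (by linarith)
  -- The number of summands in `stagedPos` depends on `t` only, so at a fixed time the position is
  -- continuous in the scale `x = r ^ ε`.
  have h2 : Continuous fun x : ℝ =>
      stagedPos (fun j => σ (Fin.ofNat w (j + 1))) (fun j => x * r ^ j) t p := by
    unfold stagedPos
    refine continuous_finsetSum _ fun i _ => ?_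
    by_cases hi : σ (Fin.ofNat w (i + 1)) = p
    · simp only [hi, if_true, stageHeight, stageStart]
      fun_prop
    · simp only [hi, if_false]
      exact continuous_const
  exact (h2.comp h1).measurable

/-- The first stage from stage `k` on that explores path `p`. -/
def nextVisit (k : ℕ) (p : Fin w) (σ : Equiv.Perm (Fin w)) : ℕ :=
  k + (σ⁻¹ p - Fin.ofNat w (k + 1)).val

lemma apply_nextVisit (k : ℕ) (p : Fin w) (σ : Equiv.Perm (Fin w)) :
    σ (Fin.ofNat w (nextVisit k p σ + 1)) = p := by
  have : Fin.ofNat w (nextVisit k p σ + 1) = σ⁻¹ p := by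
    have h1 : Fin.ofNat w (nextVisit k p σ + 1) =
        (σ⁻¹ p - Fin.ofNat w (k + 1)) + Fin.ofNat w (k + 1) := by
      ext
      simp only [nextVisit, Fin.val_ofNat, Fin.val_add, Nat.add_mod_mod]
      congr 1
      omega
    rw [h1, sub_add_cancel]
  rw [this]
  exact σ.apply_symm_apply p

lemma sum_pow_nextVisit (r : ℝ) (k : ℕ) (p : Fin w) :
    (w : ℝ) * ∑ σ : Equiv.Perm (Fin w), r ^ nextVisit k p σ =
      w.factorial * (r ^ k * ∑ i ∈ Finset.range w, r ^ i) := by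
  refine (sum_perm_inv_apply (fun q => r ^ (k + (q - Fin.ofNat w (k + 1)).val)) p).trans ?_
  congr 1
  rw [← Fin.sum_univ_eq_sum_range, Finset.mul_sum]
  refine Fintype.sum_equiv (Equiv.subRight (Fin.ofNat w (k + 1))) _ _ fun q => ?_
  rw [Equiv.subRight_apply, pow_add]

lemma lintegral_affine_rpow {r : ℝ} (hr : 1 < r) {n C a b : ℝ} (hn : 0 ≤ n) (hC : 0 ≤ C)
    (hab : a ≤ b) :
    ∫⁻ ε in Set.Ico a b, ENNReal.ofReal (n + C * r ^ ε) =
      ENNReal.ofReal ((b - a) * n + C * ((r ^ b - r ^ a) / Real.log r)) := by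
  have hr0 : 0 < r := by linarith
  have hlog := Real.log_pos hr
  have hcont : Continuous fun ε : ℝ => n + C * r ^ ε :=
    continuous_const.add (continuous_const.mul (Real.continuous_const_rpow hr0.ne'))
  rw [← ofReal_integral_eq_lintegral_ofReal]
  · congr 1
    rw [integral_Ico_eq_integral_Ioc, ← intervalIntegral.integral_of_le hab,
      intervalIntegral.integral_eq_sub_of_hasDerivAt
        (f := fun ε => ε * n + C * (r ^ ε / Real.log r))]
    · ring
    · intro ε _
      have h1 := (Real.hasStrictDerivAt_const_rpow hr0 ε).hasDerivAt
      have h2 := ((hasDerivAt_id ε).mul_const n).add ((h1.div_const (Real.log r)).const_mul C)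
      rw [mul_div_cancel_right₀ _ hlog.ne', one_mul] at h2
      exact h2
    · exact hcont.intervalIntegrable a b
  · exact (hcont.integrableOn_Icc).mono_set Set.Ico_subset_Icc_self
  · exact Filter.Eventually.of_forall fun ε => by positivity

/-- For `ε ≥ a` every stage from `k` on is long enough, so the goal is found at the next visit to
`p`. The earlier stages form a geometric sum. -/
lemma lintegral_cost_krtTrajectory_le {r : ℝ} (hr : 1 < r) (σ : Equiv.Perm (Fin w)) (p : Fin w)
    {n : ℝ} (hn : 0 ≤ n) {a b : ℝ} (ha : 0 ≤ a) (hab : a ≤ b) {k : ℕ} (hk : n ≤ r ^ a * r ^ k) :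
    ∫⁻ ε in Set.Ico a b, (krtTrajectory hr σ ε).cost p n ≤
      ENNReal.ofReal ((b - a) * n + 2 / (r - 1) * ((r ^ b - r ^ a) / Real.log r) *
        r ^ nextVisit k p σ) := by
  have hr0 : 0 < r := by linarith
  have hr1 : 0 < r - 1 := by linarith
  have hle : ∀ ε ∈ Set.Ico a b, (krtTrajectory hr σ ε).cost p n ≤
      ENNReal.ofReal (n + 2 / (r - 1) * r ^ nextVisit k p σ * r ^ ε) := by
    intro ε hε
    have h1 := (krtTrajectory_executes hr σ (ha.trans hε.1)).cost_le (j := nextVisit k p σ)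
      (fun i => by positivity) hn (by
        refine hk.trans (mul_le_mul (Real.rpow_le_rpow_of_exponent_le hr.le hε.1)
          (pow_le_pow_right₀ hr.le (Nat.le_add_right _ _)) (by positivity) (by positivity)))
    rw [apply_nextVisit] at h1
    refine h1.trans (ENNReal.ofReal_le_ofReal ?_)
    have h2 : ∑ i ∈ Finset.range (nextVisit k p σ), 2 * (r ^ ε * r ^ i) =
        2 / (r - 1) * (r ^ nextVisit k p σ - 1) * r ^ ε := by
      simp only [← mul_assoc]
      rw [← Finset.mul_sum, geom_sum_eq (by linarith)]
      ring
    have h3 : 0 ≤ 2 / (r - 1) * r ^ ε := by positivity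
    rw [h2]
    linarith
  calc _ ≤ ∫⁻ ε in Set.Ico a b, ENNReal.ofReal (n + 2 / (r - 1) * r ^ nextVisit k p σ * r ^ ε) :=
        setLIntegral_mono' measurableSet_Ico hle
    _ = _ := by
        rw [lintegral_affine_rpow hr hn (by positivity) hab]
        congr 1
        ring

lemma average_lintegral_cost_le {r : ℝ} (hr : 1 < r) (p : Fin w) {n : ℝ} (hn : 0 ≤ n) {a b : ℝ}
    (ha : 0 ≤ a) (hab : a ≤ b) {k : ℕ} (hk : n ≤ r ^ a * r ^ k) :
    (w.factorial : ℝ≥0∞)⁻¹ * ∑ σ : Equiv.Perm (Fin w),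
        ∫⁻ ε in Set.Ico a b, (krtTrajectory hr σ ε).cost p n ≤
      ENNReal.ofReal ((b - a) * n + 2 / w * rateObjective w r *
        ((r ^ b - r ^ a) / (r - 1) * r ^ k)) := by
  have hr0 : 0 < r := by linarith
  have hr1 : 0 < r - 1 := by linarith
  have hlog := Real.log_pos hr
  have hw0 : (0 : ℝ) < w := by exact_mod_cast Nat.pos_of_ne_zero (NeZero.ne w)
  have hf0 : (0 : ℝ) < w.factorial := by exact_mod_cast Nat.factorial_pos w
  have hba : 0 ≤ r ^ b - r ^ a := sub_nonneg.2 (Real.rpow_le_rpow_of_exponent_le hr.le hab)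
  have hfac : (w.factorial : ℝ≥0∞)⁻¹ = ENNReal.ofReal ((w.factorial : ℝ)⁻¹) := by
    rw [ENNReal.ofReal_inv_of_pos hf0, ENNReal.ofReal_natCast]
  calc _ ≤ (w.factorial : ℝ≥0∞)⁻¹ * ∑ σ : Equiv.Perm (Fin w),
        ENNReal.ofReal ((b - a) * n + 2 / (r - 1) * ((r ^ b - r ^ a) / Real.log r) *
          r ^ nextVisit k p σ) := by
        gcongr with σ _
        exact lintegral_cost_krtTrajectory_le hr σ p hn ha hab hk
    _ = _ := by
        rw [← ENNReal.ofReal_sum_of_nonneg fun σ _ => by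
          have := sub_nonneg.2 hab
          positivity]
        rw [hfac, ← ENNReal.ofReal_mul (by positivity)]
        congr 1
        rw [Finset.sum_add_distrib, Finset.sum_const, Finset.card_univ, Fintype.card_perm,
          Fintype.card_fin, nsmul_eq_mul, ← Finset.mul_sum, rateObjective_eq w hr]
        have h1 : ∑ σ : Equiv.Perm (Fin w), r ^ nextVisit k p σ =
            w.factorial * (r ^ k * ∑ i ∈ Finset.range w, r ^ i) / w := by
          rw [← sum_pow_nextVisit r k p]
          field_simp
        rw [h1]
        field_simp

/-- The distribution of the trajectory of the Kao–Reif–Tate algorithm. -/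
def krtMeasure (w : ℕ) [NeZero w] {r : ℝ} (hr : 1 < r) : Measure (Trajectory w) :=
  ((w.factorial : ℝ≥0∞)⁻¹) •
    ∑ σ : Equiv.Perm (Fin w), Measure.map (krtTrajectory hr σ) (volume.restrict (Set.Ico (0 : ℝ) 1))

instance {r : ℝ} (hr : 1 < r) : IsProbabilityMeasure (krtMeasure w hr) := by
  constructor
  have h1 : ∀ σ : Equiv.Perm (Fin w), Measure.map (krtTrajectory hr σ)
      (volume.restrict (Set.Ico (0 : ℝ) 1)) Set.univ = 1 := by
    intro σ
    rw [Measure.map_apply (measurable_krtTrajectory hr σ) MeasurableSet.univ]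
    simp
  rw [krtMeasure, Measure.smul_apply, Measure.finsetSum_apply]
  simp only [h1, Finset.sum_const, Finset.card_univ, Fintype.card_perm, Fintype.card_fin,
    nsmul_eq_mul, mul_one, smul_eq_mul]
  exact ENNReal.inv_mul_cancel (by exact_mod_cast (Nat.factorial_ne_zero w))
    (ENNReal.natCast_ne_top _)

/-- The Kao–Reif–Tate algorithm with rate `r`. -/
def krtAlgorithm (w : ℕ) [NeZero w] {r : ℝ} (hr : 1 < r) : RandomizedAlgorithm w :=
  ⟨krtMeasure w hr, inferInstance⟩

lemma krtAlgorithm_isKaoReifTate {r : ℝ} (hr : 1 < r) :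
    RandomizedAlgorithm.IsKaoReifTate (krtAlgorithm w hr) r :=
  ⟨krtTrajectory hr, measurable_krtTrajectory hr,
    fun σ _ hε => krtTrajectory_executes hr σ hε.1, rfl⟩

lemma expectedCost_krtAlgorithm {r : ℝ} (hr : 1 < r) (p : Fin w) {n : ℝ} (hn : 0 ≤ n) :
    RandomizedAlgorithm.expectedCost (krtAlgorithm w hr) p n =
      (w.factorial : ℝ≥0∞)⁻¹ * ∑ σ : Equiv.Perm (Fin w),
        ∫⁻ ε in Set.Ico (0 : ℝ) 1, (krtTrajectory hr σ ε).cost p n := by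
  have h1 : RandomizedAlgorithm.expectedCost (krtAlgorithm w hr) p n =
      ∫⁻ γ, γ.cost p n ∂(krtMeasure w hr) := rfl
  rw [h1, krtMeasure, lintegral_smul_measure, lintegral_finsetSum_measure, smul_eq_mul]
  congr 1
  refine Finset.sum_congr rfl fun σ _ => ?_
  rw [lintegral_map (Trajectory.measurable_cost p hn) (measurable_krtTrajectory hr σ)]

lemma expectedCost_krtAlgorithm_le {r : ℝ} (hr : 1 < r) (p : Fin w) {n : ℝ} (hn : 1 ≤ n) :
    RandomizedAlgorithm.expectedCost (krtAlgorithm w hr) p n ≤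
      ENNReal.ofReal (barR w r * n) := by
  have hr0 : 0 < r := by linarith
  have hr1 : 0 < r - 1 := by linarith
  have hn0 : 0 < n := by linarith
  have hM := rateObjective_nonneg w hr
  -- With `n = r ^ (θ + m)`, the first stage of length at least `n` is `m + 1` for `ε < θ` and `m`
  -- for `ε ≥ θ`.
  set m := ⌊Real.logb r n⌋₊ with hm
  set θ := Real.logb r n - m with hθ
  have hlogn : 0 ≤ Real.logb r n := Real.logb_nonneg hr hn
  have hθ0 : 0 ≤ θ := sub_nonneg.2 (Nat.floor_le hlogn)
  have hθ1 : θ ≤ 1 := by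
    have := Nat.lt_floor_add_one (Real.logb r n)
    rw [hθ]
    linarith
  have hn' : n = r ^ θ * r ^ m := by
    rw [← Real.rpow_natCast, ← Real.rpow_add hr0, hθ, sub_add_cancel,
      Real.rpow_logb hr0 hr.ne' hn0]
  have hrθ : r ^ θ ≤ r := by
    simpa using Real.rpow_le_rpow_of_exponent_le hr.le hθ1
  have hrθ' : 1 ≤ r ^ θ := Real.one_le_rpow hr.le hθ0
  have h1 := average_lintegral_cost_le hr p hn0.le le_rfl hθ0 (k := m + 1) (by
    rw [Real.rpow_zero, one_mul, pow_succ', hn']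
    gcongr)
  have h2 := average_lintegral_cost_le hr p hn0.le hθ0 hθ1 (k := m) hn'.le
  rw [expectedCost_krtAlgorithm hr p hn0.le]
  have hsplit : ∀ σ : Equiv.Perm (Fin w),
      ∫⁻ ε in Set.Ico (0 : ℝ) 1, (krtTrajectory hr σ ε).cost p n =
      (∫⁻ ε in Set.Ico 0 θ, (krtTrajectory hr σ ε).cost p n) +
        ∫⁻ ε in Set.Ico θ 1, (krtTrajectory hr σ ε).cost p n := by
    intro σ
    rw [← lintegral_union measurableSet_Ico, Set.Ico_union_Ico_eq_Ico hθ0 hθ1]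
    exact Set.Ico_disjoint_Ico_same
  simp only [hsplit, Finset.sum_add_distrib, mul_add]
  refine (add_le_add h1 h2).trans ?_
  rw [Real.rpow_zero, Real.rpow_one, ← ENNReal.ofReal_add]
  · refine (congrArg ENNReal.ofReal ?_).le
    rw [barR]
    -- The contributions of the two ranges of `ε` add up to exactly `n`, whatever `θ` is; this is
    -- what the uniform `ε` achieves.
    have h3 : (r ^ θ - 1) / (r - 1) * r ^ (m + 1) + (r - r ^ θ) / (r - 1) * r ^ m = n := by
      rw [hn']
      field_simp
      ring
    have h4 : 2 / (w : ℝ) * rateObjective w r * ((r ^ θ - 1) / (r - 1) * r ^ (m + 1)) +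
        2 / (w : ℝ) * rateObjective w r * ((r - r ^ θ) / (r - 1) * r ^ m) =
        2 / (w : ℝ) * rateObjective w r * n := by
      rw [← mul_add, h3]
    linarith
  · have := sub_nonneg.2 hrθ'
    rw [sub_zero]
    positivity
  · have := sub_nonneg.2 hrθ
    have := sub_nonneg.2 hθ1
    positivity

lemma expectedCost_krtAlgorithm_le_of_le_one {r : ℝ} (hr : 1 < r) (p : Fin w) {n : ℝ}
    (hn0 : 0 ≤ n) (hn : n ≤ 1) :
    RandomizedAlgorithm.expectedCost (krtAlgorithm w hr) p n ≤
      ENNReal.ofReal (n + 2 / w * rateObjective w r) := by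
  have h := average_lintegral_cost_le hr p hn0 le_rfl zero_le_one (k := 0) (by simpa using hn)
  rw [expectedCost_krtAlgorithm hr p hn0]
  refine h.trans_eq ?_
  have : r - 1 ≠ 0 := by linarith
  rw [Real.rpow_one, Real.rpow_zero, div_self this, pow_zero]
  simp

theorem krtAlgorithm_hasCompetitiveRatio {r : ℝ} (hr : 1 < r) :
    RandomizedAlgorithm.HasCompetitiveRatio (krtAlgorithm w hr) (barR w r) := by
  have hM := rateObjective_nonneg w hr
  -- The additive term is needed only for goals nearer than the shortest possible stage, so it
  -- vanishes for large `n`.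
  refine ⟨fun n => if n < 1 then 2 / w * rateObjective w r else 0, ?_, ?_⟩
  · refine (isLittleO_zero (fun n : ℝ => n) atTop).congr' ?_ EventuallyEq.rfl
    filter_upwards [eventually_ge_atTop (1 : ℝ)] with n hn
    rw [if_neg (not_lt.2 hn)]
  · intro p n hn
    dsimp only
    by_cases h : n < 1
    · refine (expectedCost_krtAlgorithm_le_of_le_one hr p hn.le h.le).trans
        (ENNReal.ofReal_le_ofReal ?_)
      rw [if_pos h, barR]
      have : 0 ≤ 2 / (w : ℝ) * rateObjective w r * n := by positivity
      linarith
    · rw [if_neg h, add_zero]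
      exact expectedCost_krtAlgorithm_le hr p (not_lt.1 h)

end

end PathSearch
end

theorem theorem3 (w : ℕ) [NeZero w] (hw : 2 ≤ w) :
    (∃! r : ℝ, PathSearch.IsOptimalRate w r) ∧
    ∀ r : ℝ, PathSearch.IsOptimalRate w r →
      (PathSearch.barR w r : EReal) ≤ PathSearch.R w ∧
      PathSearch.R w = (PathSearch.barR w r : EReal) ∧
      ∃ A : PathSearch.RandomizedAlgorithm w,
        PathSearch.RandomizedAlgorithm.IsKaoReifTate A r ∧
        PathSearch.RandomizedAlgorithm.HasCompetitiveRatio A (PathSearch.barR w r) := by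
  refine ⟨PathSearch.existsUnique_isOptimalRate hw, fun r hr => ?_⟩
  have hlower : (PathSearch.barR w r : EReal) ≤ PathSearch.R w := by
    refine le_sInf ?_
    rintro x ⟨A, c, hA, rfl⟩
    exact EReal.coe_le_coe_iff.2 (hA.barR_le (by omega) (hr.isCriticalRate hw))
  have hkrt := PathSearch.krtAlgorithm_hasCompetitiveRatio (w := w) hr.1
  exact ⟨hlower, le_antisymm (sInf_le ⟨_, _, hkrt, rfl⟩) hlower,
    _, PathSearch.krtAlgorithm_isKaoReifTate hr.1, hkrt⟩
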